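/- Let $n \ge 4$ and $c \in \mathbb{R}$, and let $\mathbb{R}^n(c)$ be the $n$-dimensional simply connected space form of constant sectional curvature $c$ (the round sphere if $c>0$, Euclidean space if $c=0$, hyperbolic space if $c<0$). Let $\Sigma$ be a connected bordered Riemann surface, i.e. a connected Hausdorff surface, possibly with boundary, with charts in the closed upper half plane whose coordinate changes are holomorphic in the interior and smooth up to the boundary. Let $u:\Sigma\to\mathbb{R}^n(c)$ be a branched immersion: a smooth (up to the boundary), weakly conformal map whose branch set $\mathcal{B}=\{p : du_p=0\}$ is discrete. Put $\Sigma_0:=\Sigma\setminus\mathcal{B}$. On $\Sigma_0$ let $H=\tfrac12\bigl(A(e_1,e_1)+A(e_2,e_2)\bigr)$ be the mean curvature vector, where $A$ is the second fundamental form of $u$ and $e_1,e_2$ is an orthonormal basis of the tangent plane $du(T_p\Sigma)$, let $\nabla^\perp$ be the normal connection and $R^\perp$ its curvature. Assume that on $\Sigma_0$ $$\nabla^\perp H\equiv 0,\qquad H\not\equiv 0,\qquad R^\perp\equiv 0 .$$ Then there is a $4$-dimensional embedded totally geodesic submanifold $P^4\subset\mathbb{R}^n(c)$, isometric to $\mathbb{R}^4(c)$,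 such that $u(\Sigma)\subset P^4$. -/

import Mathlib

open scoped Manifold ContDiff Topology

noncomputable section

/-! ### The space form of dimension `n` and constant curvature `c`

All three geometries are realised in `ℝ × ℝⁿ` with coordinates `x = (t, y)`:
the space form is `t² + c|y|² = 1` (the sheet `t > 0` if `c ≤ 0`), with the metric induced by
the flat form `⟨x, x'⟩_c = t t' / c + y · y'`.  For `c > 0` this is the round sphere of
radius `1/√c` and for `c < 0` the hyperboloid model `⟨x, x⟩_c = 1/c` in Minkowski space (the
coordinate `t` being rescaled by `√|c|`).  For `c = 0` it is the affine hyperplane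
`t = 1`, i.e. `ℝⁿ`; its tangent vectors are the `(0, z)` and the form is `y · y'`
(Lean's convention `0⁻¹ = 0` makes the first term vanish). -/

/-- The flat ambient vector space `ℝ × ℝⁿ`. -/
abbrev FlatAmbient (n : ℕ) : Type := ℝ × EuclideanSpace ℝ (Fin n)

/-- The flat bilinear form `⟨v, w⟩_c = v₀ w₀ / c + v' · w'`. -/
def ambForm {n : ℕ} (c : ℝ) (v w : FlatAmbient n) : ℝ :=
  c⁻¹ * (v.1 * w.1) + inner ℝ v.2 w.2

/-- The simply connected `n`-dimensional space form `ℝⁿ(c)` of curvature `c` (for `n ≥ 2`). -/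
def spaceForm (n : ℕ) (c : ℝ) : Set (FlatAmbient n) :=
  {x | x.1 ^ 2 + c * ‖x.2‖ ^ 2 = 1 ∧ (c ≤ 0 → 0 < x.1)}

/-- The differential at `x` (up to the factor `2`) of the defining function `t² + c|y|²`;
equal to `c ⟨x, v⟩_c` when `c ≠ 0`. -/
def conormalForm {n : ℕ} (c : ℝ) (x v : FlatAmbient n) : ℝ :=
  x.1 * v.1 + c * inner ℝ x.2 v.2

/-- `v` is tangent to the space form at its point `x`. -/
def IsTangentAt {n : ℕ} (c : ℝ) (x v : FlatAmbient n) : Prop :=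
  conormalForm c x v = 0

/-- Projection of ambient vectors at `x` to the tangent space of the space form along `ℝ x`.
For `c ≠ 0` it is the orthogonal projection.  For `c = 0` it fixes all vectors `(0, z)`, and only
those occur as derivatives of tangent fields. -/
def tangentProj {n : ℕ} (c : ℝ) (x v : FlatAmbient n) : FlatAmbient n :=
  v - conormalForm c x v • x

/-- A (complete, affinely parametrised, possibly constant) geodesic `ℝ → ℝⁿ(c)`: the
covariant acceleration, i.e. the tangential part of the flat acceleration, vanishes. -/
structure IsSpaceFormGeodesic (n : ℕ) (c : ℝ) (γ : ℝ → FlatAmbient n) : Prop where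
  smooth : ContDiff ℝ ∞ γ
  mem : ∀ t, γ t ∈ spaceForm n c
  accel : ∀ t, tangentProj c (γ t) (deriv (deriv γ) t) = 0

/-- `P` is an embedded totally geodesic submanifold of `ℝⁿ(c)` isometric to `ℝᵐ(c)`: it is the
image of an isometric embedding `F : ℝᵐ(c) → ℝⁿ(c)` that maps geodesics to geodesics.
(A map defined on the closed submanifold `ℝᵐ(c)` is smooth iff it is the restriction of a
smooth map of the ambient vector space.) -/
def IsTotallyGeodesicSpaceForm (m n : ℕ) (c : ℝ) (P : Set (FlatAmbient n)) : Prop :=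
  ∃ F : FlatAmbient m → FlatAmbient n,
    ContDiff ℝ ∞ F ∧
    Set.MapsTo F (spaceForm m c) (spaceForm n c) ∧
    Topology.IsEmbedding ((spaceForm m c).domRestrict F) ∧
    (∀ x ∈ spaceForm m c, ∀ v w, IsTangentAt c x v → IsTangentAt c x w →
      ambForm c (fderiv ℝ F x v) (fderiv ℝ F x w) = ambForm c v w) ∧
    (∀ γ, IsSpaceFormGeodesic m c γ → IsSpaceFormGeodesic n c (F ∘ γ)) ∧
    F '' spaceForm m c = P

/-! ### Bordered Riemann surfaces -/

/-- The closed upper half plane. -/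
abbrev ClosedHalfPlane : Type := {z : ℂ // 0 ≤ z.im}

theorem range_closedHalfPlane_val :
    Set.range (Subtype.val : ClosedHalfPlane → ℂ) = {z : ℂ | 0 ≤ z.im} :=
  Subtype.range_coe

/-- The closed upper half plane as a *complex* model with boundary.  A bordered Riemann surface is
a space charted on it with `IsManifold halfPlaneModel ∞`: coordinate changes are complex
differentiable, holomorphic in the interior and smooth up to the boundary. -/
def halfPlaneModel : ModelWithCorners ℂ ℂ ClosedHalfPlane where
  toFun := Subtype.val
  invFun z := ⟨⟨z.re, max z.im 0⟩, le_max_right _ _⟩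
  source := Set.univ
  target := {z | 0 ≤ z.im}
  map_source' z _ := z.property
  map_target' _ _ := Set.mem_univ _
  left_inv' := fun ⟨z, hz⟩ _ => by
    apply Subtype.ext
    apply Complex.ext
    · rfl
    · exact max_eq_left hz
  right_inv' z hz := by
    apply Complex.ext
    · rfl
    · exact max_eq_left hz
  source_eq := rfl
  convex_range' := by
    simp only [instIsRCLikeNormedField, ↓reduceDIte]
    apply Convex.convex_isRCLikeNormedField
    change Convex ℝ (Set.range (Subtype.val : ClosedHalfPlane → ℂ))
    rw [range_closedHalfPlane_val]
    exact convex_halfSpace_im_ge 0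
  nonempty_interior' := by
    change (interior (Set.range (Subtype.val : ClosedHalfPlane → ℂ))).Nonempty
    rw [range_closedHalfPlane_val]
    refine ⟨Complex.I, mem_interior.2 ⟨{z | 0 < z.im}, fun z hz => le_of_lt (a := (0 : ℝ)) (b := z.im) hz, ?_, ?_⟩⟩
    · exact isOpen_lt continuous_const Complex.continuous_im
    · simp
  continuous_toFun := continuous_subtype_val
  continuous_invFun := by
    refine Continuous.subtype_mk ?_ _
    exact Complex.equivRealProdCLM.symm.continuous.comp
      (Complex.continuous_re.prodMk (Complex.continuous_im.max continuous_const))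

section Surface

variable {S : Type*} [TopologicalSpace S]

/-- The derivative of `g` at `p` along the constant coordinate field `v ∈ ℂ = ℝ²` of the complex
coordinate `e` (so `v = 1` and `v = i` give `∂g/∂x¹` and `∂g/∂x²`). -/
def coordDeriv {F : Type*} [NormedAddCommGroup F] [NormedSpace ℝ F]
    (e : OpenPartialHomeomorph S ClosedHalfPlane) (g : S → F) (v : ℂ) (p : S) : F :=
  fderivWithin ℝ (g ∘ (e.extend halfPlaneModel).symm) {z : ℂ | 0 ≤ z.im}
    (e.extend halfPlaneModel p) v

/-- `g` is (real) smooth, up to the boundary, on the open subset `U` of the surface. -/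
def SmoothOnSurface [ChartedSpace ClosedHalfPlane S] {F : Type*} [NormedAddCommGroup F]
    [NormedSpace ℝ F] (g : S → F) (U : Set S) : Prop :=
  ∀ e ∈ atlas ClosedHalfPlane S,
    ContDiffOn ℝ ∞ (g ∘ (e.extend halfPlaneModel).symm)
      ((e.extend halfPlaneModel).target ∩ (e.extend halfPlaneModel).symm ⁻¹' U)

variable {n : ℕ}

/-- The branch points of `u`: the points where `du = 0`. -/
def branchSet [ChartedSpace ClosedHalfPlane S] (u : S → FlatAmbient n) : Set S :=
  {p | ∀ v : ℂ, coordDeriv (chartAt ClosedHalfPlane p) u v p = 0}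

/-- `u` is a branched immersion into `ℝⁿ(c)`: smooth, weakly conformal, and immersed
except on a discrete set.  (By weak conformality `du` is injective where it does not vanish.) -/
structure IsBranchedImmersion [ChartedSpace ClosedHalfPlane S] (c : ℝ) (u : S → FlatAmbient n) :
    Prop where
  mem : ∀ p, u p ∈ spaceForm n c
  smooth : SmoothOnSurface u Set.univ
  conformal_norm : ∀ e ∈ atlas ClosedHalfPlane S, ∀ p ∈ e.source,
    ambForm c (coordDeriv e u 1 p) (coordDeriv e u 1 p) =
      ambForm c (coordDeriv e u Complex.I p) (coordDeriv e u Complex.I p)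
  conformal_orthogonal : ∀ e ∈ atlas ClosedHalfPlane S, ∀ p ∈ e.source,
    ambForm c (coordDeriv e u 1 p) (coordDeriv e u Complex.I p) = 0
  discrete_branchSet : IsDiscrete (branchSet u)

/-! In the following definitions `e` is a complex coordinate of the surface and `u` is weakly
conformal, so that off the branch points the coordinate fields
`∂₁u`, `∂₂u` form an orthogonal basis of the tangent plane `du(T_pS)`. -/

/-- The Levi-Civita connection of `ℝⁿ(c)` along `u`, applied to a field `ξ` of vectors tangent to
`ℝⁿ(c)` along `u`: the tangential part of the flat derivative. -/
def ambientCovDeriv (c : ℝ) (u : S → FlatAmbient n)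
    (e : OpenPartialHomeomorph S ClosedHalfPlane) (v : ℂ) (ξ : S → FlatAmbient n) (p : S) :
    FlatAmbient n :=
  tangentProj c (u p) (coordDeriv e ξ v p)

/-- The component `X^⊥` of `X ∈ T_{u(p)}ℝⁿ(c)` orthogonal to `du(T_pS)`, for `p` not a branch
point. -/
def normalPart (c : ℝ) (u : S → FlatAmbient n)
    (e : OpenPartialHomeomorph S ClosedHalfPlane) (p : S) (X : FlatAmbient n) : FlatAmbient n :=
  X - (ambForm c X (coordDeriv e u 1 p) /
        ambForm c (coordDeriv e u 1 p) (coordDeriv e u 1 p)) • coordDeriv e u 1 p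
    - (ambForm c X (coordDeriv e u Complex.I p) /
        ambForm c (coordDeriv e u Complex.I p) (coordDeriv e u Complex.I p)) •
          coordDeriv e u Complex.I p

/-- The normal connection `∇^⊥_v ξ`. -/
def normalCovDeriv (c : ℝ) (u : S → FlatAmbient n)
    (e : OpenPartialHomeomorph S ClosedHalfPlane) (v : ℂ) (ξ : S → FlatAmbient n) (p : S) :
    FlatAmbient n :=
  normalPart c u e p (ambientCovDeriv c u e v ξ p)

/-- The second fundamental form `A(∂_v u, ∂_w u) = (∇_v ∂_w u)^⊥`. -/
def secondFundForm (c : ℝ) (u : S → FlatAmbient n)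
    (e : OpenPartialHomeomorph S ClosedHalfPlane) (v w : ℂ) (p : S) : FlatAmbient n :=
  normalPart c u e p (ambientCovDeriv c u e v (coordDeriv e u w) p)

/-- The mean curvature vector `H = (A(e₁,e₁) + A(e₂,e₂)) / 2` for the orthonormal basis
`eᵢ = ∂ᵢu / |∂ᵢu|` of `du(T_pS)`.  It does not depend on the complex coordinate `e`. -/
def meanCurvature (c : ℝ) (u : S → FlatAmbient n)
    (e : OpenPartialHomeomorph S ClosedHalfPlane) (p : S) : FlatAmbient n :=
  (1 / 2 : ℝ) •
    ((ambForm c (coordDeriv e u 1 p) (coordDeriv e u 1 p))⁻¹ • secondFundForm c u e 1 1 p +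
     (ambForm c (coordDeriv e u Complex.I p) (coordDeriv e u Complex.I p))⁻¹ •
        secondFundForm c u e Complex.I Complex.I p)

/-- `∇^⊥ H = 0` off the branch points. -/
def HasParallelMeanCurvature [ChartedSpace ClosedHalfPlane S] (c : ℝ) (u : S → FlatAmbient n) :
    Prop :=
  ∀ e ∈ atlas ClosedHalfPlane S, ∀ p ∈ e.source, p ∉ branchSet u → ∀ v : ℂ,
    normalCovDeriv c u e v (meanCurvature c u e) p = 0

/-- `H` vanishes identically off the branch points. -/
def MeanCurvatureVanishes [ChartedSpace ClosedHalfPlane S] (c : ℝ) (u : S → FlatAmbient n) :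
    Prop :=
  ∀ e ∈ atlas ClosedHalfPlane S, ∀ p ∈ e.source, p ∉ branchSet u → meanCurvature c u e p = 0

/-- `ξ` is a smooth section of the normal bundle of `u` over `U`, where `U` is an open subset
of the domain of the coordinate `e` without branch points. -/
structure IsNormalSection [ChartedSpace ClosedHalfPlane S] (c : ℝ) (u : S → FlatAmbient n)
    (e : OpenPartialHomeomorph S ClosedHalfPlane) (U : Set S) (ξ : S → FlatAmbient n) :
    Prop where
  smooth : SmoothOnSurface ξ U
  tangent : ∀ p ∈ U, IsTangentAt c (u p) (ξ p)
  normal : ∀ p ∈ U, ∀ v : ℂ, ambForm c (ξ p) (coordDeriv e u v p) = 0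

/-- The normal curvature `R^⊥(X, Y) ξ = ∇^⊥_X ∇^⊥_Y ξ - ∇^⊥_Y ∇^⊥_X ξ - ∇^⊥_{[X,Y]} ξ` for the
constant coordinate fields `X = v`, `Y = w`, for which `[X, Y] = 0`. -/
def normalCurvature (c : ℝ) (u : S → FlatAmbient n)
    (e : OpenPartialHomeomorph S ClosedHalfPlane) (v w : ℂ) (ξ : S → FlatAmbient n) (p : S) :
    FlatAmbient n :=
  normalCovDeriv c u e v (normalCovDeriv c u e w ξ) p -
    normalCovDeriv c u e w (normalCovDeriv c u e v ξ) p

/-- `R^⊥ = 0` off the branch points. -/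
def HasFlatNormalBundle [ChartedSpace ClosedHalfPlane S] (c : ℝ) (u : S → FlatAmbient n) :
    Prop :=
  ∀ e ∈ atlas ClosedHalfPlane S, ∀ U : Set S, IsOpen U → U ⊆ e.source \ branchSet u →
    ∀ ξ : S → FlatAmbient n, IsNormalSection c u e U ξ →
      ∀ p ∈ U, ∀ v w : ℂ, normalCurvature c u e v w ξ p = 0

end Surface

end

/-! ### Removing countable sets from planar domains -/

/-! In a complex coordinate write `α = A(∂₁,∂₁) - A(∂₂,∂₂)` and `γ = 2A(∂₁,∂₂)`, so that `φ = α -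
iγ` is the vector valued Hopf differential. Since `H` is parallel, the Codazzi equations are the
Cauchy-Riemann equations of `φ` for the normal connection (`codazzi_fst`, `codazzi_snd`), hence the
quartic differential `⟨φ,φ⟩` is holomorphic (`differentiableOn_hopfQuartic`). Since `R^⊥ = 0`, the
Ricci equation makes `α` and `γ` parallel (`ricci`), hence `⟨φ,φ⟩` vanishes only where `φ` does. So
`φ` vanishes identically or only on a countable set.

Off that set, parallelism and Codazzi express the normal derivatives of `α`, `γ` through `α`, `γ`
themselves. The six fields `U, ∂₁U, ∂₂U, H, α, γ` then solve a closed linear first order system, and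
by Grönwall a linear functional that kills all six at one point kills `U` on the whole patch. A
planar domain stays connected when a countable set is removed, so the zeros of `φ` do no harm
(`exists_countable_propagation`). At a single point the six vectors span dimension at most five,
because `α` and `γ` are parallel: a patch lies in a linear subspace `W` of dimension at most `5` of
`ℝ × ℝⁿ` (`exists_submodule`).

The same propagation gives unique continuation for linear functions of `u`, and connectedness of the
surface spreads `u ∈ W` to all of it; boundary and branch points are reached as limits of patches.
Finally `W` meets the space form inside a totally geodesic `ℝ⁴(c)`, the image of a linear map that
respects the forms (`exists_isTotallyGeodesicSpaceForm`). -/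

theorem isPreconnected_ball_diff_countable (z : ℂ) {r : ℝ} (hr : 0 < r) {C : Set ℂ}
    (hC : C.Countable) : IsPreconnected (Metric.ball z r \ C) := by
  have hrank : 1 < Module.rank ℝ ℂ := by rw [Complex.rank_real_complex]; norm_num
  -- The ball is homeomorphic to all of `ℂ`, where complements of countable sets are connected
  -- because the real dimension exceeds one.
  set e := OpenPartialHomeomorph.univBall z r with he
  have hsrc : e.source = Set.univ := OpenPartialHomeomorph.univBall_source z r
  have htgt : e.target = Metric.ball z r := OpenPartialHomeomorph.univBall_target z hr
  have hinj : Function.Injective e := by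
    rw [← Set.injOn_univ, ← hsrc]; exact e.injOn
  have hcont : Continuous e := by
    rw [← continuousOn_univ, ← hsrc]; exact e.continuousOn
  have himg : Metric.ball z r \ C = e '' (e ⁻¹' C)ᶜ := by
    rw [← Set.preimage_compl, Set.image_preimage_eq_inter_range, ← Set.image_univ, ← hsrc,
      e.image_source_eq_target, htgt, Set.inter_comm]
    rfl
  rw [himg]
  exact ((hC.preimage hinj).isConnected_compl_of_one_lt_rank hrank).isPreconnected.image _
    hcont.continuousOn

/-- A ball minus `C` is connected, so it lies entirely in one of two separating sets. Sorting the
points of `Ω` by the side on which their small balls lie would separate `Ω` itself. -/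
theorem IsPreconnected.diff_countable {Ω C : Set ℂ} (hΩ : IsPreconnected Ω) (hop : IsOpen Ω)
    (hC : C.Countable) : IsPreconnected (Ω \ C) := by
  intro U V hU hV hsub hUne hVne
  by_contra hne
  have key : ∀ z ∈ Ω, ∀ r > 0, Metric.ball z r ⊆ Ω →
      Metric.ball z r \ C ⊆ U ∨ Metric.ball z r \ C ⊆ V := by
    intro z hz r hr hball
    have hsubb : Metric.ball z r \ C ⊆ Ω \ C := Set.sdiff_subset_sdiff_left hball
    by_contra hcon
    push Not at hcon
    obtain ⟨⟨x, hx, hxU⟩, ⟨y, hy, hyV⟩⟩ :=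
      And.intro (Set.not_subset.1 hcon.1) (Set.not_subset.1 hcon.2)
    have hxV : x ∈ V := (hsub (hsubb hx)).resolve_left hxU
    have hyU : y ∈ U := (hsub (hsubb hy)).resolve_right hyV
    obtain ⟨w, hw, hw'⟩ := isPreconnected_ball_diff_countable z hr hC U V hU hV
      (hsubb.trans hsub) ⟨y, hy, hyU⟩ ⟨x, hx, hxV⟩
    exact hne ⟨w, hsubb hw, hw'⟩
  have hopen : ∀ A : Set ℂ,
      IsOpen {z | ∃ r > 0, Metric.ball z r ⊆ Ω ∧ Metric.ball z r \ C ⊆ A} := by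
    intro A
    rw [Metric.isOpen_iff]
    rintro z ⟨r, hr, h1, h2⟩
    refine ⟨r / 2, by positivity, fun w hw => ⟨r / 2, by positivity, ?_⟩⟩
    have hsm : Metric.ball w (r / 2) ⊆ Metric.ball z r :=
      Metric.ball_subset_ball' (by have := Metric.mem_ball.1 hw; linarith)
    exact ⟨hsm.trans h1, (Set.sdiff_subset_sdiff_left hsm).trans h2⟩
  have hmem : ∀ A : Set ℂ, IsOpen A → ((Ω \ C) ∩ A).Nonempty →
      (Ω ∩ {z | ∃ r > 0, Metric.ball z r ⊆ Ω ∧ Metric.ball z r \ C ⊆ A}).Nonempty := by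
    rintro A hA ⟨x, hx, hxA⟩
    obtain ⟨r, hr, hrsub⟩ := Metric.isOpen_iff.1 (hop.inter hA) x ⟨hx.1, hxA⟩
    exact ⟨x, hx.1, r, hr, fun w hw => (hrsub hw).1, fun w hw => (hrsub hw.1).2⟩
  obtain ⟨z, hz, ⟨r, hr, h1, h2⟩, ⟨r', hr', h1', h2'⟩⟩ := hΩ _ _ (hopen U) (hopen V) (by
      intro z hz
      obtain ⟨r, hr, hball⟩ := Metric.isOpen_iff.1 hop z hz
      rcases key z hz r hr hball with h | h
      · exact Or.inl ⟨r, hr, hball, h⟩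
      · exact Or.inr ⟨r, hr, hball, h⟩)
    (hmem U hU hUne) (hmem V hV hVne)
  -- Two balls about the same centre lie on different sides; any point of the smaller one outside
  -- `C` is in both.
  obtain ⟨w, hw, hwC⟩ := (hC.dense_compl ℝ).inter_open_nonempty (Metric.ball z (min r r'))
    Metric.isOpen_ball ⟨z, Metric.mem_ball_self (lt_min hr hr')⟩
  have hw1 := Metric.ball_subset_ball (min_le_left r r') hw
  have hw2 := Metric.ball_subset_ball (min_le_right r r') hw
  exact hne ⟨w, ⟨h1 hw1, hwC⟩, h2 ⟨hw1, hwC⟩, h2' ⟨hw2, hwC⟩⟩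

theorem IsDiscrete.countable_of_secondCountable {X : Type*} [TopologicalSpace X]
    [SecondCountableTopology X] {s : Set X} (hs : IsDiscrete s) : s.Countable := by
  have := hs.to_subtype
  exact Set.countable_coe_iff.1 (countable_of_Lindelof_of_discrete (X := s))

theorem countable_zeros_of_differentiableOn {Ω : Set ℂ} (hop : IsOpen Ω) (hΩ : IsPreconnected Ω)
    {q : ℂ → ℂ} (hq : DifferentiableOn ℂ q Ω) (hne : ¬ Set.EqOn q 0 Ω) :
    (Ω ∩ {z | q z = 0}).Countable := by
  have hev := ((hq.analyticOnNhd hop).eqOn_zero_or_eventually_ne_zero_of_preconnected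
    hΩ).resolve_left hne
  rw [Set.inter_comm]
  exact (isDiscrete_of_codiscreteWithin (s := {z | q z = 0}) hev).countable_of_secondCountable

/-! ### Linear systems with continuous coefficients -/

section ContSpan

variable {ι E : Type*} [Fintype ι] [NormedAddCommGroup E] [NormedSpace ℝ E]

/-- `f` is a combination of the fields `X j` with coefficients continuous on `Ω`. -/
def ContSpan (X : ι → ℂ → E) (Ω : Set ℂ) (f : ℂ → E) : Prop :=
  ∃ m : ι → ℂ → ℝ, (∀ j, ContinuousOn (m j) Ω) ∧ ∀ z ∈ Ω, f z = ∑ j, m j z • X j z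

variable {X : ι → ℂ → E} {Ω : Set ℂ} {f g : ℂ → E}

theorem ContSpan.add (hf : ContSpan X Ω f) (hg : ContSpan X Ω g) :
    ContSpan X Ω (fun z => f z + g z) := by
  obtain ⟨m, hm, hf⟩ := hf
  obtain ⟨k, hk, hg⟩ := hg
  refine ⟨fun j z => m j z + k j z, fun j => (hm j).add (hk j), fun z hz => ?_⟩
  simp only [hf z hz, hg z hz, add_smul, Finset.sum_add_distrib]

theorem ContSpan.smul {a : ℂ → ℝ} (ha : ContinuousOn a Ω) (hf : ContSpan X Ω f) :
    ContSpan X Ω (fun z => a z • f z) := by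
  obtain ⟨m, hm, hf⟩ := hf
  refine ⟨fun j z => a z * m j z, fun j => ha.mul (hm j), fun z hz => ?_⟩
  simp only [hf z hz, Finset.smul_sum, mul_smul]

theorem ContSpan.congr (hf : ContSpan X Ω f) (h : ∀ z ∈ Ω, g z = f z) : ContSpan X Ω g := by
  obtain ⟨m, hm, hf⟩ := hf
  exact ⟨m, hm, fun z hz => (h z hz).trans (hf z hz)⟩

theorem ContSpan.single (j : ι) : ContSpan X Ω (X j) := by
  classical
  refine ⟨fun i _ => if i = j then 1 else 0, fun _ => continuousOn_const, fun z _ => ?_⟩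
  simp

theorem ContSpan.zero : ContSpan X Ω (fun _ => 0) :=
  ⟨fun _ _ => 0, fun _ => continuousOn_const, fun z _ => by simp⟩

/-- A functional that kills the fields of a closed linear system at a point kills them nearby. -/
theorem eventually_eq_zero_of_contSpan (hop : IsOpen Ω)
    (hX : ∀ i, DifferentiableOn ℝ (X i) Ω)
    (h1 : ∀ i, ContSpan X Ω (fun z => fderiv ℝ (X i) z 1))
    (hI : ∀ i, ContSpan X Ω (fun z => fderiv ℝ (X i) z Complex.I))
    (l : E →L[ℝ] ℝ) {z₀ : ℂ} (hz₀ : z₀ ∈ Ω) (h0 : ∀ i, l (X i z₀) = 0) :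
    ∀ᶠ z in 𝓝 z₀, ∀ i, l (X i z) = 0 := by
  choose m hm hmX using h1
  choose k hk hkX using hI
  set y : ℂ → ι → ℝ := fun z i => l (X i z) with hy
  set K : ℂ → ℝ := fun z => ∑ i, ∑ j, (|m i j z| + |k i j z|) with hK
  have hKc : ContinuousAt K z₀ := by
    have : ContinuousOn K Ω := by
      refine continuousOn_finsetSum _ fun i _ => continuousOn_finsetSum _ fun j _ => ?_
      exact (hm i j).abs.add (hk i j).abs
    exact this.continuousAt (hop.mem_nhds hz₀)
  -- By continuity `K z₀ + 1` bounds the coefficients on a whole ball, which makes the Grönwall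
  -- constant uniform along each radius.
  obtain ⟨r, hr, hball⟩ := Metric.eventually_nhds_iff_ball.1
    ((hKc.eventually (gt_mem_nhds (lt_add_one (K z₀)))).and (hop.mem_nhds hz₀))
  have hder : ∀ z ∈ Ω, ∀ v : ℂ, ∀ i,
      fderiv ℝ (X i) z v = v.re • fderiv ℝ (X i) z 1 + v.im • fderiv ℝ (X i) z Complex.I := by
    intro z _ v i
    rw [← map_smul, ← map_smul, ← map_add]
    congr 1
    apply Complex.ext <;> simp
  have hbound : ∀ z ∈ Ω, ∀ v : ℂ, ∀ i, |l (fderiv ℝ (X i) z v)| ≤ ‖v‖ * (K z * ‖y z‖) := by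
    intro z hz v i
    have hyj : ∀ j, |l (X j z)| ≤ ‖y z‖ := fun j => norm_le_pi_norm (y z) j
    have e1 : l (fderiv ℝ (X i) z v) =
        ∑ j, (v.re * m i j z + v.im * k i j z) * l (X j z) := by
      rw [hder z hz v i, show fderiv ℝ (X i) z 1 = _ from hmX i z hz,
        show fderiv ℝ (X i) z Complex.I = _ from hkX i z hz]
      simp only [map_add, map_smul, map_sum, smul_eq_mul, Finset.mul_sum, ← Finset.sum_add_distrib]
      exact Finset.sum_congr rfl fun j _ => by ring
    rw [e1]
    calc |∑ j, (v.re * m i j z + v.im * k i j z) * l (X j z)|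
        ≤ ∑ j, ‖v‖ * ((|m i j z| + |k i j z|) * ‖y z‖) := by
          refine (Finset.abs_sum_le_sum_abs _ _).trans (Finset.sum_le_sum fun j _ => ?_)
          rw [abs_mul, ← mul_assoc]
          refine mul_le_mul ?_ (hyj j) (abs_nonneg _) (by positivity)
          refine (abs_add_le _ _).trans ?_
          rw [abs_mul, abs_mul, mul_add]
          gcongr
          · exact Complex.abs_re_le_norm v
          · exact Complex.abs_im_le_norm v
      _ = ‖v‖ * ((∑ j, (|m i j z| + |k i j z|)) * ‖y z‖) := by
          rw [← Finset.mul_sum, Finset.sum_mul]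
      _ ≤ _ := by
          gcongr
          exact Finset.single_le_sum (f := fun i => ∑ j, (|m i j z| + |k i j z|))
            (fun i _ => Finset.sum_nonneg fun j _ => by positivity) (Finset.mem_univ i)
  refine Metric.eventually_nhds_iff_ball.2 ⟨r, hr, fun z hz => ?_⟩
  have hline : ∀ t ∈ Set.Icc (0 : ℝ) 1, z₀ + t • (z - z₀) ∈ Metric.ball z₀ r := by
    intro t ht
    rw [Metric.mem_ball, dist_eq_norm] at hz ⊢
    rw [add_sub_cancel_left, norm_smul, Real.norm_of_nonneg ht.1]
    exact lt_of_le_of_lt (mul_le_of_le_one_left (norm_nonneg _) ht.2) hz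
  have hderiv : ∀ t ∈ Set.Icc (0 : ℝ) 1, HasDerivAt (fun t : ℝ => y (z₀ + t • (z - z₀)))
      (fun i => l (fderiv ℝ (X i) (z₀ + t • (z - z₀)) (z - z₀))) t := by
    intro t ht
    rw [hasDerivAt_pi]
    intro i
    have hin := (hball _ (hline t ht)).2
    have hf := ((hX i).differentiableAt (hop.mem_nhds hin)).hasFDerivAt
    have hl : HasDerivAt (fun t : ℝ => z₀ + t • (z - z₀)) (z - z₀) t := by
      simpa using ((hasDerivAt_id t).smul_const (z - z₀)).const_add z₀
    exact l.hasFDerivAt.comp_hasDerivAt t (hf.comp_hasDerivAt t hl)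
  have hzero := eq_zero_of_abs_deriv_le_mul_abs_self_of_eq_zero_right
    (K := ‖z - z₀‖ * (K z₀ + 1)) (a := 0) (b := 1)
    (f := fun t : ℝ => y (z₀ + t • (z - z₀)))
    (fun t ht => (hderiv t ht).continuousAt.continuousWithinAt)
    (fun t ht => (hderiv t (Set.Ico_subset_Icc_self ht)).hasDerivWithinAt)
    (by funext i; simpa [hy] using h0 i)
    (by
      intro t ht
      have ht' := hball _ (hline t (Set.Ico_subset_Icc_self ht))
      have hKpos : 0 ≤ K z₀ + 1 := by
        have : 0 ≤ K z₀ := Finset.sum_nonneg fun i _ => Finset.sum_nonneg fun j _ => by positivity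
        linarith
      rw [pi_norm_le_iff_of_nonneg (by positivity)]
      intro i
      refine (hbound _ ht'.2 _ i).trans ?_
      rw [mul_assoc]
      gcongr
      exact ht'.1.le)
    1 (by simp)
  intro i
  have := congrFun hzero i
  simpa [hy] using this

/-- The points near which the functional kills all fields form an open set. It is closed in `Ω`: at
a limit point the values vanish by continuity and the local lemma starts again there. -/
theorem eq_zero_of_contSpan (hop : IsOpen Ω) (hΩ : IsPreconnected Ω)
    (hX : ∀ i, DifferentiableOn ℝ (X i) Ω)
    (h1 : ∀ i, ContSpan X Ω (fun z => fderiv ℝ (X i) z 1))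
    (hI : ∀ i, ContSpan X Ω (fun z => fderiv ℝ (X i) z Complex.I))
    (l : E →L[ℝ] ℝ) {z₀ : ℂ} (hz₀ : z₀ ∈ Ω) (h0 : ∀ i, l (X i z₀) = 0) :
    ∀ z ∈ Ω, ∀ i, l (X i z) = 0 := by
  have hsub : Ω ⊆ {z | ∀ᶠ w in 𝓝 z, ∀ i, l (X i w) = 0} := by
    refine hΩ.subset_of_closure_inter_subset isOpen_setOfPred_eventually_nhds
      ⟨z₀, hz₀, eventually_eq_zero_of_contSpan hop hX h1 hI l hz₀ h0⟩ ?_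
    rintro z ⟨hzc, hz⟩
    refine eventually_eq_zero_of_contSpan hop hX h1 hI l hz fun i => ?_
    have hcont : ContinuousAt (fun w => l (X i w)) z :=
      l.continuous.continuousAt.comp ((hX i).continuousOn.continuousAt (hop.mem_nhds hz))
    have hmem := hcont.continuousWithinAt.mem_closure hzc (t := {(0 : ℝ)})
      fun w (hw : ∀ᶠ w in 𝓝 w, ∀ i, l (X i w) = 0) => hw.self_of_nhds i
    simpa using hmem
  exact fun z hz => Filter.Eventually.self_of_nhds (hsub hz)

end ContSpan

/-! ### The flat form and the conormal form -/

section Forms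

variable {n : ℕ} {c : ℝ}

theorem ambForm_comm (v w : FlatAmbient n) : ambForm c v w = ambForm c w v := by
  simp only [ambForm, mul_comm v.1, real_inner_comm]

theorem ambForm_add_left (v v' w : FlatAmbient n) :
    ambForm c (v + v') w = ambForm c v w + ambForm c v' w := by
  simp only [ambForm, Prod.fst_add, Prod.snd_add, inner_add_left]; ring

theorem ambForm_smul_left (a : ℝ) (v w : FlatAmbient n) :
    ambForm c (a • v) w = a * ambForm c v w := by
  simp only [ambForm, Prod.smul_fst, Prod.smul_snd, real_inner_smul_left, smul_eq_mul]; ring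

theorem ambForm_sub_left (v v' w : FlatAmbient n) :
    ambForm c (v - v') w = ambForm c v w - ambForm c v' w := by
  simp only [ambForm, Prod.fst_sub, Prod.snd_sub, inner_sub_left]; ring

theorem ambForm_add_right (v w w' : FlatAmbient n) :
    ambForm c v (w + w') = ambForm c v w + ambForm c v w' := by
  simp only [ambForm, Prod.fst_add, Prod.snd_add, inner_add_right]; ring

theorem ambForm_smul_right (a : ℝ) (v w : FlatAmbient n) :
    ambForm c v (a • w) = a * ambForm c v w := by
  simp only [ambForm, Prod.smul_fst, Prod.smul_snd, real_inner_smul_right, smul_eq_mul]; ring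

theorem ambForm_sub_right (v w w' : FlatAmbient n) :
    ambForm c v (w - w') = ambForm c v w - ambForm c v w' := by
  simp only [ambForm, Prod.fst_sub, Prod.snd_sub, inner_sub_right]; ring

theorem ambForm_zero_right (v : FlatAmbient n) : ambForm c v 0 = 0 := by
  simp [ambForm]

theorem conormalForm_comm (v w : FlatAmbient n) : conormalForm c v w = conormalForm c w v := by
  simp only [conormalForm, mul_comm v.1, real_inner_comm]

theorem conormalForm_add_right (v w w' : FlatAmbient n) :
    conormalForm c v (w + w') = conormalForm c v w + conormalForm c v w' := by
  simp only [conormalForm, Prod.fst_add, Prod.snd_add, inner_add_right]; ring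

theorem conormalForm_smul_right (a : ℝ) (v w : FlatAmbient n) :
    conormalForm c v (a • w) = a * conormalForm c v w := by
  simp only [conormalForm, Prod.smul_fst, Prod.smul_snd, real_inner_smul_right, smul_eq_mul]; ring

theorem conormalForm_sub_right (v w w' : FlatAmbient n) :
    conormalForm c v (w - w') = conormalForm c v w - conormalForm c v w' := by
  simp only [conormalForm, Prod.fst_sub, Prod.snd_sub, inner_sub_right]; ring

theorem conormalForm_eq_mul_ambForm (hc : c ≠ 0) (v w : FlatAmbient n) :
    conormalForm c v w = c * ambForm c v w := by
  simp only [conormalForm, ambForm]; field_simp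

theorem conormalForm_self {x : FlatAmbient n} (hx : x ∈ spaceForm n c) :
    conormalForm c x x = 1 := by
  rw [conormalForm, real_inner_self_eq_norm_sq, ← hx.1]; ring

theorem fst_eq_one_of_mem_spaceForm {x : FlatAmbient n} (hx : x ∈ spaceForm n 0) : x.1 = 1 := by
  have h1 := hx.1
  have h2 := hx.2 le_rfl
  nlinarith

theorem IsTangentAt.fst_eq_zero {x v : FlatAmbient n} (hx : x ∈ spaceForm n 0)
    (hv : IsTangentAt 0 x v) : v.1 = 0 := by
  simpa [IsTangentAt, conormalForm, fst_eq_one_of_mem_spaceForm hx] using hv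

/-- For `c ≠ 0` tangency is irrelevant; for `c = 0` it makes the first coordinate of `v` zero, so
that both sides vanish. -/
theorem conormalForm_of_tangent {x v w : FlatAmbient n} (hx : x ∈ spaceForm n c)
    (hv : IsTangentAt c x v) : conormalForm c v w = c * ambForm c v w := by
  by_cases hc : c = 0
  · subst hc
    simp [conormalForm, hv.fst_eq_zero hx]
  · exact conormalForm_eq_mul_ambForm hc v w

/-- For a tangent vector, `c ⟨x, v⟩_c` vanishes in all three geometries. -/
theorem mul_ambForm_of_tangent {x v : FlatAmbient n} (hv : IsTangentAt c x v) :
    c * ambForm c x v = 0 := by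
  by_cases hc : c = 0
  · simp [hc]
  · rw [← conormalForm_eq_mul_ambForm hc]; exact hv

/-- The form is definite for `c > 0`, and Euclidean on vectors `(0, z)` for `c = 0`. For `c < 0` it
is Lorentzian and `x` is timelike, so its orthogonal complement is spacelike. -/
theorem ambForm_self_pos_of_tangent {x v : FlatAmbient n} (hx : x ∈ spaceForm n c)
    (hv : IsTangentAt c x v) (hne : v ≠ 0) : 0 < ambForm c v v := by
  have hinner : inner ℝ v.2 v.2 = ‖v.2‖ ^ 2 := real_inner_self_eq_norm_sq v.2
  rcases lt_trichotomy c 0 with hc | hc | hc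
  · have hx1 := hx.1
    have hx0 := hx.2 hc.le
    have hv' : x.1 * v.1 + c * inner ℝ x.2 v.2 = 0 := hv
    have hcs := abs_real_inner_le_norm x.2 v.2
    have hcs2 : (inner ℝ x.2 v.2) ^ 2 ≤ ‖x.2‖ ^ 2 * ‖v.2‖ ^ 2 := by
      rw [← mul_pow, ← sq_abs]
      exact pow_le_pow_left₀ (abs_nonneg _) hcs 2
    have hv2 : v.2 ≠ 0 := by
      intro h0
      apply hne
      rw [h0, inner_zero_right, mul_zero, add_zero] at hv'
      exact Prod.ext ((mul_eq_zero.1 hv').resolve_left hx0.ne') h0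
    have hpos : 0 < ‖v.2‖ ^ 2 := by positivity
    -- Tangency replaces `x.1 * v.1` by `-c⟨x.2, v.2⟩`; Cauchy-Schwarz and the equation of the
    -- hyperboloid then bound the left side by `c‖v.2‖²`.
    have hkey : x.1 ^ 2 * (v.1 ^ 2 + c * ‖v.2‖ ^ 2) < 0 := by
      have e1 : x.1 ^ 2 * v.1 ^ 2 = c ^ 2 * (inner ℝ x.2 v.2) ^ 2 := by
        have : x.1 * v.1 = -(c * inner ℝ x.2 v.2) := by linarith
        rw [← mul_pow, this]; ring
      have e2 : c ^ 2 * (inner ℝ x.2 v.2) ^ 2 ≤ c ^ 2 * (‖x.2‖ ^ 2 * ‖v.2‖ ^ 2) := by gcongr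
      have e3 : c * ‖x.2‖ ^ 2 = 1 - x.1 ^ 2 := by linarith
      have e4 : c ^ 2 * (‖x.2‖ ^ 2 * ‖v.2‖ ^ 2) = c * (1 - x.1 ^ 2) * ‖v.2‖ ^ 2 := by
        rw [← e3]; ring
      nlinarith [mul_neg_of_neg_of_pos hc hpos]
    have hneg : v.1 ^ 2 + c * ‖v.2‖ ^ 2 < 0 := by
      by_contra hcon
      push Not at hcon
      have := mul_nonneg (sq_nonneg x.1) hcon
      linarith
    have : ambForm c v v = c⁻¹ * (v.1 ^ 2 + c * ‖v.2‖ ^ 2) := by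
      rw [ambForm, hinner, mul_add, inv_mul_cancel_left₀ hc.ne]; ring
    rw [this]
    exact mul_pos_of_neg_of_neg (inv_lt_zero.2 hc) hneg
  · subst hc
    have h1 := hv.fst_eq_zero hx
    have hv2 : v.2 ≠ 0 := fun h0 => hne (Prod.ext h1 h0)
    rw [ambForm, hinner, h1]
    have : 0 < ‖v.2‖ ^ 2 := by positivity
    simpa using this
  · rw [ambForm, hinner]
    have hv12 : v.1 ≠ 0 ∨ v.2 ≠ 0 := by
      by_contra hcon
      push Not at hcon
      exact hne (Prod.ext hcon.1 hcon.2)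
    have h1 : 0 ≤ c⁻¹ * (v.1 * v.1) := mul_nonneg (inv_pos.2 hc).le (mul_self_nonneg _)
    rcases hv12 with h | h
    · have : 0 < c⁻¹ * (v.1 * v.1) := mul_pos (inv_pos.2 hc) (mul_self_pos.2 h)
      positivity
    · have : 0 < ‖v.2‖ ^ 2 := by positivity
      linarith

end Forms

/-! ### Directional derivatives in the plane -/

section PlaneDeriv

variable {F : Type*} [NormedAddCommGroup F] [NormedSpace ℝ F] {n : ℕ} {c : ℝ}

/-- The derivative of `f` in the constant direction `v`. -/
noncomputable def planeDeriv (v : ℂ) (f : ℂ → F) (z : ℂ) : F := fderiv ℝ f z v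

variable {f g : ℂ → F} {z v w : ℂ} {Ω : Set ℂ}

theorem ContDiffOn.differentiableAt_of_isOpen (hop : IsOpen Ω) (hf : ContDiffOn ℝ ∞ f Ω)
    (hz : z ∈ Ω) : DifferentiableAt ℝ f z :=
  (hf.differentiableOn (by simp)).differentiableAt (hop.mem_nhds hz)

theorem ContDiffOn.planeDeriv (hop : IsOpen Ω) (hf : ContDiffOn ℝ ∞ f Ω) (v : ℂ) :
    ContDiffOn ℝ ∞ (planeDeriv v f) Ω :=
  (hf.fderiv_of_isOpen hop (by simp)).clm_apply contDiffOn_const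

theorem planeDeriv_congr (hop : IsOpen Ω) (h : ∀ w ∈ Ω, f w = g w) (hz : z ∈ Ω) :
    planeDeriv v f z = planeDeriv v g z := by
  have : f =ᶠ[𝓝 z] g := Filter.eventually_of_mem (hop.mem_nhds hz) h
  simp only [planeDeriv, this.fderiv_eq]

theorem planeDeriv_const (a : F) : planeDeriv v (fun _ => a) z = 0 := by
  simp [planeDeriv]

theorem planeDeriv_add (hf : DifferentiableAt ℝ f z) (hg : DifferentiableAt ℝ g z) :
    planeDeriv v (fun w => f w + g w) z = planeDeriv v f z + planeDeriv v g z := by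
  simp only [planeDeriv, fderiv_fun_add hf hg, add_apply]

theorem planeDeriv_sub (hf : DifferentiableAt ℝ f z) (hg : DifferentiableAt ℝ g z) :
    planeDeriv v (fun w => f w - g w) z = planeDeriv v f z - planeDeriv v g z := by
  simp only [planeDeriv, fderiv_fun_sub hf hg, sub_apply]

theorem planeDeriv_smul {a : ℂ → ℝ} (ha : DifferentiableAt ℝ a z) (hf : DifferentiableAt ℝ f z) :
    planeDeriv v (fun w => a w • f w) z = a z • planeDeriv v f z + planeDeriv v a z • f z := by
  simp only [planeDeriv, fderiv_fun_smul ha hf, add_apply,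
    smul_apply, ContinuousLinearMap.smulRight_apply]

theorem planeDeriv_const_smul (a : ℝ) (hf : DifferentiableAt ℝ f z) :
    planeDeriv v (fun w => a • f w) z = a • planeDeriv v f z := by
  simp only [planeDeriv, fderiv_fun_const_smul hf, smul_apply]

theorem planeDeriv_comm (hop : IsOpen Ω) (hf : ContDiffOn ℝ ∞ f Ω) (hz : z ∈ Ω) (v w : ℂ) :
    planeDeriv v (planeDeriv w f) z = planeDeriv w (planeDeriv v f) z := by
  have hat : ContDiffAt ℝ ∞ f z := hf.contDiffAt (hop.mem_nhds hz)
  have hsymm : IsSymmSndFDerivAt ℝ f z := hat.isSymmSndFDerivAt (by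
    rw [minSmoothness_of_isRCLikeNormedField]; exact WithTop.coe_le_coe.2 (le_top (a := (2 : ℕ∞))))
  have hd : DifferentiableAt ℝ (fderiv ℝ f) z :=
    (hat.fderiv_right (m := ∞) (by simp)).differentiableAt (by simp)
  have e : ∀ v w : ℂ, planeDeriv v (planeDeriv w f) z = fderiv ℝ (fderiv ℝ f) z v w := by
    intro v w
    change fderiv ℝ (fun x => fderiv ℝ f x w) z v = _
    rw [fderiv_clm_apply hd (by fun_prop)]
    simp
  rw [e, e, hsymm.eq]

/-- One Leibniz rule serves both forms: `(a, b) = (c⁻¹, 1)` gives `ambForm` and `(1, c)` gives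
`conormalForm`. -/
theorem planeDeriv_prodForm (a b : ℝ) {f g : ℂ → FlatAmbient n} (hf : DifferentiableAt ℝ f z)
    (hg : DifferentiableAt ℝ g z) :
    planeDeriv v (fun w => a * ((f w).1 * (g w).1) + b * inner ℝ (f w).2 (g w).2) z =
      (a * ((planeDeriv v f z).1 * (g z).1) + b * inner ℝ (planeDeriv v f z).2 (g z).2) +
      (a * ((f z).1 * (planeDeriv v g z).1) + b * inner ℝ (f z).2 (planeDeriv v g z).2) := by
  have hf1 := hf.hasFDerivAt.fst
  have hf2 := hf.hasFDerivAt.snd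
  have hg1 := hg.hasFDerivAt.fst
  have hg2 := hg.hasFDerivAt.snd
  have := (((hf1.mul hg1).const_mul a).add ((hf2.inner ℝ hg2).const_mul b)).fderiv
  change fderiv ℝ _ z v = _
  erw [this]
  simp [planeDeriv, fderivInnerCLM_apply]
  ring

theorem planeDeriv_ambForm {f g : ℂ → FlatAmbient n} (hf : DifferentiableAt ℝ f z)
    (hg : DifferentiableAt ℝ g z) :
    planeDeriv v (fun w => ambForm c (f w) (g w)) z =
      ambForm c (planeDeriv v f z) (g z) + ambForm c (f z) (planeDeriv v g z) := by
  simpa [ambForm] using planeDeriv_prodForm (v := v) c⁻¹ 1 hf hg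

theorem planeDeriv_conormalForm {f g : ℂ → FlatAmbient n} (hf : DifferentiableAt ℝ f z)
    (hg : DifferentiableAt ℝ g z) :
    planeDeriv v (fun w => conormalForm c (f w) (g w)) z =
      conormalForm c (planeDeriv v f z) (g z) + conormalForm c (f z) (planeDeriv v g z) := by
  simpa [conormalForm] using planeDeriv_prodForm (v := v) 1 c hf hg

theorem ContDiffOn.ambForm {f g : ℂ → FlatAmbient n} (hf : ContDiffOn ℝ ∞ f Ω)
    (hg : ContDiffOn ℝ ∞ g Ω) : ContDiffOn ℝ ∞ (fun z => ambForm c (f z) (g z)) Ω :=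
  (contDiffOn_const.mul (hf.fst.mul hg.fst)).add (hf.snd.inner ℝ hg.snd)

end PlaneDeriv

/-! ### Orthogonal frames and the normal projection at a point -/

section Frame

variable {n : ℕ} {c : ℝ}

/-- `a`, `b` span a plane tangent to the space form at `x`, are orthogonal and of equal length. -/
structure IsConformalFrame (c : ℝ) (x a b : FlatAmbient n) : Prop where
  mem : x ∈ spaceForm n c
  tangent_fst : conormalForm c x a = 0
  tangent_snd : conormalForm c x b = 0
  norm_eq : ambForm c a a = ambForm c b b
  orth : ambForm c a b = 0
  norm_ne : ambForm c a a ≠ 0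

/-- `ξ` is tangent to the space form at `x` and orthogonal to `a` and `b`. -/
structure IsNormalVector (c : ℝ) (x a b ξ : FlatAmbient n) : Prop where
  tangent : conormalForm c x ξ = 0
  orth_fst : ambForm c ξ a = 0
  orth_snd : ambForm c ξ b = 0

/-- The projection of ambient vectors to the normal space of the plane spanned by `a` and `b`. -/
noncomputable def normalProj (c : ℝ) (x a b : FlatAmbient n) :
    FlatAmbient n →ₗ[ℝ] FlatAmbient n where
  toFun X := tangentProj c x X - (ambForm c (tangentProj c x X) a / ambForm c a a) • a
    - (ambForm c (tangentProj c x X) b / ambForm c b b) • b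
  map_add' X Y := by
    simp only [tangentProj, conormalForm_add_right, ambForm_sub_left, ambForm_add_left,
      ambForm_smul_left]
    module
  map_smul' r X := by
    simp only [tangentProj, conormalForm_smul_right, ambForm_sub_left,
      ambForm_smul_left, RingHom.id_apply]
    module

theorem normalProj_apply (x a b X : FlatAmbient n) : normalProj c x a b X =
    tangentProj c x X - (ambForm c (tangentProj c x X) a / ambForm c a a) • a
      - (ambForm c (tangentProj c x X) b / ambForm c b b) • b := rfl

variable {x a b X ξ η : FlatAmbient n}

theorem tangentProj_of_tangent (h : conormalForm c x X = 0) : tangentProj c x X = X := by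
  simp [tangentProj, h]

theorem IsConformalFrame.normalProj_point (h : IsConformalFrame c x a b) :
    normalProj c x a b x = 0 := by
  have : tangentProj c x x = 0 := by simp [tangentProj, conormalForm_self h.mem]
  rw [normalProj_apply, this]
  simp [ambForm]

theorem IsConformalFrame.normalProj_fst (h : IsConformalFrame c x a b) :
    normalProj c x a b a = 0 := by
  rw [normalProj_apply, tangentProj_of_tangent h.tangent_fst, h.orth, div_self h.norm_ne]
  simp

theorem IsConformalFrame.normalProj_snd (h : IsConformalFrame c x a b) :
    normalProj c x a b b = 0 := by
  rw [normalProj_apply, tangentProj_of_tangent h.tangent_snd, ambForm_comm b a, h.orth,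
    div_self (h.norm_eq ▸ h.norm_ne)]
  simp

theorem IsConformalFrame.isNormalVector_normalProj (h : IsConformalFrame c x a b)
    (X : FlatAmbient n) : IsNormalVector c x a b (normalProj c x a b X) := by
  have hb : ambForm c b b ≠ 0 := h.norm_eq ▸ h.norm_ne
  have ha := h.norm_ne
  refine ⟨?_, ?_, ?_⟩
  · simp only [normalProj_apply, tangentProj, conormalForm_sub_right, conormalForm_smul_right,
      h.tangent_fst, h.tangent_snd, conormalForm_self h.mem]
    ring
  · rw [normalProj_apply, ambForm_sub_left, ambForm_sub_left, ambForm_smul_left,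
      ambForm_smul_left, ambForm_comm b a, h.orth]
    field_simp
    ring
  · rw [normalProj_apply, ambForm_sub_left, ambForm_sub_left, ambForm_smul_left,
      ambForm_smul_left, h.orth]
    field_simp
    ring

theorem IsNormalVector.normalProj_eq (h : IsNormalVector c x a b ξ) :
    normalProj c x a b ξ = ξ := by
  rw [normalProj_apply, tangentProj_of_tangent h.tangent, h.orth_fst, h.orth_snd]
  simp

theorem IsNormalVector.smul (h : IsNormalVector c x a b ξ) (r : ℝ) :
    IsNormalVector c x a b (r • ξ) :=
  ⟨by rw [conormalForm_smul_right, h.tangent, mul_zero],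
    by rw [ambForm_smul_left, h.orth_fst, mul_zero],
    by rw [ambForm_smul_left, h.orth_snd, mul_zero]⟩

theorem IsNormalVector.eq_zero_of_ambForm (hx : x ∈ spaceForm n c)
    (h : IsNormalVector c x a b ξ) (h0 : ambForm c ξ ξ = 0) : ξ = 0 := by
  by_contra hne
  exact (ambForm_self_pos_of_tangent hx h.tangent hne).ne' h0

theorem IsNormalVector.ambForm_nonneg (hx : x ∈ spaceForm n c)
    (h : IsNormalVector c x a b ξ) : 0 ≤ ambForm c ξ ξ := by
  by_cases hne : ξ = 0
  · simp [hne, ambForm]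
  · exact (ambForm_self_pos_of_tangent hx h.tangent hne).le

/-- For vectors tangent to the space form the normal projection is self-adjoint. -/
theorem IsNormalVector.ambForm_normalProj (h : IsNormalVector c x a b η)
    (hX : conormalForm c x X = 0) : ambForm c (normalProj c x a b X) η = ambForm c X η := by
  rw [normalProj_apply, tangentProj_of_tangent hX, ambForm_sub_left, ambForm_sub_left,
    ambForm_smul_left, ambForm_smul_left, ambForm_comm a η, ambForm_comm b η, h.orth_fst,
    h.orth_snd]
  ring

/-- Two normal vectors with `⟨γ,γ⟩ α = ⟨α,γ⟩ γ` are parallel, so the relation is symmetric. -/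
theorem parallel_symm {α γ : FlatAmbient n} (hx : x ∈ spaceForm n c)
    (hγ : IsNormalVector c x a b γ) (h : ambForm c γ γ • α = ambForm c α γ • γ) :
    ambForm c α α • γ = ambForm c α γ • α := by
  by_cases h0 : ambForm c γ γ = 0
  · rw [hγ.eq_zero_of_ambForm hx h0]
    simp [ambForm]
  · obtain ⟨t, rfl⟩ : ∃ t : ℝ, α = t • γ := by
      refine ⟨ambForm c α γ / ambForm c γ γ, ?_⟩
      rw [div_eq_inv_mul, mul_smul, ← h, smul_smul, inv_mul_cancel₀ h0, one_smul]
    simp only [ambForm_smul_left, ambForm_smul_right, smul_smul]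
    congr 1
    ring

end Frame

/-! ### Conformal patches -/

local notation "∂₁" => planeDeriv (1 : ℂ)
local notation "∂₂" => planeDeriv Complex.I

section Patch

variable {n : ℕ}

/-- A conformal immersion of a plane domain into the space form. -/
structure IsConformalPatch (c : ℝ) (U : ℂ → FlatAmbient n) (Ω : Set ℂ) : Prop where
  isOpen : IsOpen Ω
  smooth : ContDiffOn ℝ ∞ U Ω
  mem : ∀ z ∈ Ω, U z ∈ spaceForm n c
  norm_eq : ∀ z ∈ Ω, ambForm c (∂₁ U z) (∂₁ U z) = ambForm c (∂₂ U z) (∂₂ U z)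
  orth : ∀ z ∈ Ω, ambForm c (∂₁ U z) (∂₂ U z) = 0
  norm_ne : ∀ z ∈ Ω, ambForm c (∂₁ U z) (∂₁ U z) ≠ 0

/-- The normal projection of a patch at the parameter `z`. -/
noncomputable def patchNormal (c : ℝ) (U : ℂ → FlatAmbient n) (z : ℂ) :
    FlatAmbient n →ₗ[ℝ] FlatAmbient n :=
  normalProj c (U z) (∂₁ U z) (∂₂ U z)

/-- Smooth sections of the normal bundle of a patch. -/
structure IsPatchNormalField (c : ℝ) (U : ℂ → FlatAmbient n) (Ω : Set ℂ)
    (ξ : ℂ → FlatAmbient n) : Prop where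
  smooth : ContDiffOn ℝ ∞ ξ Ω
  normal : ∀ z ∈ Ω, IsNormalVector c (U z) (∂₁ U z) (∂₂ U z) (ξ z)

/-- The conformal factor `|∂₁U|²`. -/
noncomputable def confFactor (c : ℝ) (U : ℂ → FlatAmbient n) (z : ℂ) : ℝ :=
  ambForm c (∂₁ U z) (∂₁ U z)

/-- The logarithmic derivative of the conformal factor in the direction `v`. -/
noncomputable def confLogDeriv (c : ℝ) (U : ℂ → FlatAmbient n) (v z : ℂ) : ℝ :=
  planeDeriv v (confFactor c U) z / confFactor c U z

/-- The mean curvature vector of a patch. -/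
noncomputable def patchMeanCurvature (c : ℝ) (U : ℂ → FlatAmbient n) (z : ℂ) : FlatAmbient n :=
  (1 / 2 : ℝ) • ((ambForm c (∂₁ U z) (∂₁ U z))⁻¹ • patchNormal c U z (∂₁ (∂₁ U) z) +
    (ambForm c (∂₂ U z) (∂₂ U z))⁻¹ • patchNormal c U z (∂₂ (∂₂ U) z))

/-- The real part `A(∂₁,∂₁) - A(∂₂,∂₂)` of the (vector valued) Hopf differential. -/
noncomputable def hopfRe (c : ℝ) (U : ℂ → FlatAmbient n) (z : ℂ) : FlatAmbient n :=
  ∂₁ (∂₁ U) z - ∂₂ (∂₂ U) z - confLogDeriv c U 1 z • ∂₁ U z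
    + confLogDeriv c U Complex.I z • ∂₂ U z

/-- The negative imaginary part `2 A(∂₁,∂₂)` of the (vector valued) Hopf differential. -/
noncomputable def hopfIm (c : ℝ) (U : ℂ → FlatAmbient n) (z : ℂ) : FlatAmbient n :=
  (2 : ℝ) • ∂₁ (∂₂ U) z - confLogDeriv c U Complex.I z • ∂₁ U z - confLogDeriv c U 1 z • ∂₂ U z

/-- The mean curvature vector of the patch is parallel and its normal bundle is flat. -/
structure IsParallelFlatPatch (c : ℝ) (U : ℂ → FlatAmbient n) (Ω : Set ℂ) : Prop
    extends IsConformalPatch c U Ω where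
  parallel : ∀ z ∈ Ω, ∀ v, patchNormal c U z (planeDeriv v (patchMeanCurvature c U) z) = 0
  flat : ∀ ξ, IsPatchNormalField c U Ω ξ → ∀ z ∈ Ω,
    patchNormal c U z (∂₁ (fun w => patchNormal c U w (∂₂ ξ w)) z) =
      patchNormal c U z (∂₂ (fun w => patchNormal c U w (∂₁ ξ w)) z)

variable {c : ℝ} {U : ℂ → FlatAmbient n} {Ω : Set ℂ} {z : ℂ}

theorem conormalForm_planeDeriv_eq_zero (hop : IsOpen Ω) (hs : ContDiffOn ℝ ∞ U Ω)
    (hmem : ∀ z ∈ Ω, U z ∈ spaceForm n c) (hz : z ∈ Ω) (v : ℂ) :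
    conormalForm c (U z) (planeDeriv v U z) = 0 := by
  have h1 := planeDeriv_congr (v := v) (g := fun _ => (1 : ℝ)) hop
    (fun w hw => conormalForm_self (hmem w hw)) hz
  have hd := hs.differentiableAt_of_isOpen hop hz
  rw [planeDeriv_conormalForm hd hd, planeDeriv_const,
    conormalForm_comm (planeDeriv v U z)] at h1
  linarith

namespace IsConformalPatch

variable (h : IsConformalPatch c U Ω)
include h

theorem diffAt (hz : z ∈ Ω) : DifferentiableAt ℝ U z :=
  h.smooth.differentiableAt_of_isOpen h.isOpen hz

theorem smooth_deriv (v : ℂ) : ContDiffOn ℝ ∞ (planeDeriv v U) Ω :=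
  h.smooth.planeDeriv h.isOpen v

theorem diffAt_deriv (hz : z ∈ Ω) (v : ℂ) : DifferentiableAt ℝ (planeDeriv v U) z :=
  (h.smooth_deriv v).differentiableAt_of_isOpen h.isOpen hz

theorem smooth_confFactor : ContDiffOn ℝ ∞ (confFactor c U) Ω :=
  (h.smooth_deriv 1).ambForm (h.smooth_deriv 1)

theorem smooth_confLogDeriv (v : ℂ) : ContDiffOn ℝ ∞ (confLogDeriv c U v) Ω :=
  (h.smooth_confFactor.planeDeriv h.isOpen v).div h.smooth_confFactor h.norm_ne

theorem smooth_hopfRe : ContDiffOn ℝ ∞ (hopfRe c U) Ω :=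
  ((((h.smooth_deriv 1).planeDeriv h.isOpen 1).sub
    ((h.smooth_deriv _).planeDeriv h.isOpen _)).sub
      ((h.smooth_confLogDeriv 1).smul (h.smooth_deriv 1))).add
        ((h.smooth_confLogDeriv _).smul (h.smooth_deriv _))

theorem smooth_hopfIm : ContDiffOn ℝ ∞ (hopfIm c U) Ω :=
  ((((h.smooth_deriv _).planeDeriv h.isOpen 1).const_smul (2 : ℝ)).sub
      ((h.smooth_confLogDeriv _).smul (h.smooth_deriv 1))).sub
        ((h.smooth_confLogDeriv 1).smul (h.smooth_deriv _))

theorem tangent_deriv (hz : z ∈ Ω) (v : ℂ) : conormalForm c (U z) (planeDeriv v U z) = 0 :=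
  conormalForm_planeDeriv_eq_zero h.isOpen h.smooth h.mem hz v

theorem frame (hz : z ∈ Ω) : IsConformalFrame c (U z) (∂₁ U z) (∂₂ U z) :=
  ⟨h.mem z hz, h.tangent_deriv hz 1, h.tangent_deriv hz _, h.norm_eq z hz, h.orth z hz,
    h.norm_ne z hz⟩

/-- The conormal component of the flat derivative of a field tangent to the space form. -/
theorem conormalForm_deriv_of_tangent {ξ : ℂ → FlatAmbient n} (hξ : ContDiffOn ℝ ∞ ξ Ω)
    (ht : ∀ w ∈ Ω, conormalForm c (U w) (ξ w) = 0) (hz : z ∈ Ω) (v : ℂ) :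
    conormalForm c (U z) (planeDeriv v ξ z) = -(c * ambForm c (planeDeriv v U z) (ξ z)) := by
  have h1 := planeDeriv_congr (v := v) (g := fun _ => (0 : ℝ)) h.isOpen ht hz
  rw [planeDeriv_conormalForm (h.diffAt hz) (hξ.differentiableAt_of_isOpen h.isOpen hz),
    planeDeriv_const, conormalForm_of_tangent (h.mem z hz) (h.tangent_deriv hz v)] at h1
  linarith

theorem conormalForm_deriv_deriv (hz : z ∈ Ω) (v w : ℂ) :
    conormalForm c (U z) (planeDeriv v (planeDeriv w U) z) =
      -(c * ambForm c (planeDeriv v U z) (planeDeriv w U z)) :=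
  h.conormalForm_deriv_of_tangent (h.smooth_deriv w) (fun _ hx => h.tangent_deriv hx w) hz v

/-- The projection removes a multiple of `U` whose coefficient carries a factor `c`, and `c⟨U, ∂U⟩ =
0` even when `c = 0`. -/
theorem ambForm_tangentProj_deriv_deriv (hz : z ∈ Ω) (v w k : ℂ) :
    ambForm c (tangentProj c (U z) (planeDeriv v (planeDeriv w U) z)) (planeDeriv k U z) =
      ambForm c (planeDeriv v (planeDeriv w U) z) (planeDeriv k U z) := by
  rw [tangentProj, ambForm_sub_left, ambForm_smul_left, h.conormalForm_deriv_deriv hz]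
  have := mul_ambForm_of_tangent (h.tangent_deriv hz k)
  linear_combination (ambForm c (planeDeriv v U z) (planeDeriv w U z)) * this

/-- This and the next two identities are the Christoffel symbols of a conformal metric, found by
differentiating `|∂₁U|² = |∂₂U|²` and `⟨∂₁U, ∂₂U⟩ = 0`. -/
theorem deriv_deriv_fst_fst (hz : z ∈ Ω) (v : ℂ) :
    ambForm c (planeDeriv v (∂₁ U) z) (∂₁ U z) = planeDeriv v (confFactor c U) z / 2 := by
  have := planeDeriv_ambForm (c := c) (v := v) (h.diffAt_deriv hz 1) (h.diffAt_deriv hz 1)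
  rw [ambForm_comm (∂₁ U z)] at this
  change planeDeriv v (confFactor c U) z = _ at this
  linarith

theorem deriv_deriv_snd_snd (hz : z ∈ Ω) (v : ℂ) :
    ambForm c (planeDeriv v (∂₂ U) z) (∂₂ U z) = planeDeriv v (confFactor c U) z / 2 := by
  have := planeDeriv_ambForm (c := c) (v := v) (h.diffAt_deriv hz Complex.I)
    (h.diffAt_deriv hz Complex.I)
  rw [ambForm_comm (∂₂ U z), ← planeDeriv_congr (f := confFactor c U) h.isOpen h.norm_eq hz]
    at this
  linarith

theorem deriv_deriv_fst_snd (hz : z ∈ Ω) (v : ℂ) :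
    ambForm c (planeDeriv v (∂₁ U) z) (∂₂ U z) =
      -ambForm c (planeDeriv v (∂₂ U) z) (∂₁ U z) := by
  have := planeDeriv_ambForm (c := c) (v := v) (h.diffAt_deriv hz 1) (h.diffAt_deriv hz Complex.I)
  rw [ambForm_comm (∂₁ U z), planeDeriv_congr (g := fun _ => (0 : ℝ)) h.isOpen h.orth hz,
    planeDeriv_const] at this
  linarith

theorem deriv_comm (hz : z ∈ Ω) : ∂₂ (∂₁ U) z = ∂₁ (∂₂ U) z :=
  planeDeriv_comm h.isOpen h.smooth hz _ _

/-- Gauss formula; the term along `U` is the second fundamental form of the space form in the flat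
ambient space. -/
theorem patchNormal_deriv_deriv (hz : z ∈ Ω) (v w : ℂ) :
    patchNormal c U z (planeDeriv v (planeDeriv w U) z) =
      planeDeriv v (planeDeriv w U) z
        + (c * ambForm c (planeDeriv v U z) (planeDeriv w U z)) • U z
        - (ambForm c (planeDeriv v (planeDeriv w U) z) (∂₁ U z) / confFactor c U z) • ∂₁ U z
        - (ambForm c (planeDeriv v (planeDeriv w U) z) (∂₂ U z) / confFactor c U z) • ∂₂ U z := by
  rw [patchNormal, normalProj_apply, h.ambForm_tangentProj_deriv_deriv hz,
    h.ambForm_tangentProj_deriv_deriv hz, ← h.norm_eq z hz, tangentProj,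
    h.conormalForm_deriv_deriv hz, confFactor]
  module

theorem patchNormal_fst_fst (hz : z ∈ Ω) : patchNormal c U z (∂₁ (∂₁ U) z) =
    ∂₁ (∂₁ U) z + (c * confFactor c U z) • U z - (confLogDeriv c U 1 z / 2) • ∂₁ U z
      + (confLogDeriv c U Complex.I z / 2) • ∂₂ U z := by
  rw [h.patchNormal_deriv_deriv hz, h.deriv_deriv_fst_fst hz, h.deriv_deriv_fst_snd hz,
    ← h.deriv_comm hz, h.deriv_deriv_fst_fst hz, confLogDeriv, confLogDeriv,
    show ambForm c (∂₁ U z) (∂₁ U z) = confFactor c U z from rfl]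
  module

theorem patchNormal_snd_snd (hz : z ∈ Ω) : patchNormal c U z (∂₂ (∂₂ U) z) =
    ∂₂ (∂₂ U) z + (c * confFactor c U z) • U z + (confLogDeriv c U 1 z / 2) • ∂₁ U z
      - (confLogDeriv c U Complex.I z / 2) • ∂₂ U z := by
  have e : ambForm c (∂₂ (∂₂ U) z) (∂₁ U z) = -(∂₁ (confFactor c U) z / 2) := by
    rw [← h.deriv_deriv_snd_snd hz, ← h.deriv_comm hz, h.deriv_deriv_fst_snd hz, neg_neg]
  rw [h.patchNormal_deriv_deriv hz, e, h.deriv_deriv_snd_snd hz, confLogDeriv, confLogDeriv,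
    ← h.norm_eq z hz, show ambForm c (∂₁ U z) (∂₁ U z) = confFactor c U z from rfl]
  module

/-- The term along `U` drops out because `∂₁U ⊥ ∂₂U`; in `patchNormal_fst_fst_sub` it cancels
because the lengths agree. Thus the explicit formulas, visibly smooth, are also normal. -/
theorem two_smul_patchNormal_fst_snd (hz : z ∈ Ω) :
    (2 : ℝ) • patchNormal c U z (∂₁ (∂₂ U) z) = hopfIm c U z := by
  have e : ambForm c (∂₁ (∂₂ U) z) (∂₁ U z) = ∂₂ (confFactor c U) z / 2 := by
    rw [← h.deriv_comm hz, h.deriv_deriv_fst_fst hz]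
  rw [h.patchNormal_deriv_deriv hz, e, h.deriv_deriv_snd_snd hz, h.orth z hz, hopfIm,
    confLogDeriv, confLogDeriv]
  module

theorem patchNormal_fst_fst_sub (hz : z ∈ Ω) :
    patchNormal c U z (∂₁ (∂₁ U) z) - patchNormal c U z (∂₂ (∂₂ U) z) = hopfRe c U z := by
  rw [h.patchNormal_fst_fst hz, h.patchNormal_snd_snd hz, hopfRe]
  module

theorem isPatchNormalField_hopfRe : IsPatchNormalField c U Ω (hopfRe c U) :=
  ⟨h.smooth_hopfRe, fun z hz => by
    rw [← h.patchNormal_fst_fst_sub hz, ← map_sub]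
    exact (h.frame hz).isNormalVector_normalProj _⟩

theorem isPatchNormalField_hopfIm : IsPatchNormalField c U Ω (hopfIm c U) :=
  ⟨h.smooth_hopfIm, fun z hz => by
    rw [← h.two_smul_patchNormal_fst_snd hz]
    exact ((h.frame hz).isNormalVector_normalProj _).smul _⟩

/-- In conformal coordinates the first order terms of the two Gauss formulas cancel, leaving only
`H` and the position vector. -/
theorem laplacian_eq (hz : z ∈ Ω) : ∂₁ (∂₁ U) z + ∂₂ (∂₂ U) z =
    (2 * confFactor c U z) • (patchMeanCurvature c U z - c • U z) := by
  have hne : confFactor c U z ≠ 0 := h.norm_ne z hz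
  rw [patchMeanCurvature, ← h.norm_eq z hz,
    show ambForm c (∂₁ U z) (∂₁ U z) = confFactor c U z from rfl, ← smul_add,
    h.patchNormal_fst_fst hz, h.patchNormal_snd_snd hz, smul_smul, smul_sub, smul_smul,
    show 2 * confFactor c U z * (1 / 2 * (confFactor c U z)⁻¹) = 1 by field_simp]
  module

theorem patchMeanCurvature_eq (hz : z ∈ Ω) : patchMeanCurvature c U z =
    (2 * confFactor c U z)⁻¹ • (∂₁ (∂₁ U) z + ∂₂ (∂₂ U) z) + c • U z := by
  have hne : confFactor c U z ≠ 0 := h.norm_ne z hz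
  rw [h.laplacian_eq hz, smul_smul, inv_mul_cancel₀ (by positivity), one_smul, sub_add_cancel]

theorem smooth_patchMeanCurvature : ContDiffOn ℝ ∞ (patchMeanCurvature c U) Ω := by
  have : ContDiffOn ℝ ∞ (fun z => (2 * confFactor c U z)⁻¹ • (∂₁ (∂₁ U) z + ∂₂ (∂₂ U) z)
      + c • U z) Ω :=
    (((contDiffOn_const.mul h.smooth_confFactor).inv fun z hz =>
      mul_ne_zero two_ne_zero (h.norm_ne z hz)).smul
      (((h.smooth_deriv 1).planeDeriv h.isOpen 1).add
        ((h.smooth_deriv _).planeDeriv h.isOpen _))).add (h.smooth.const_smul c)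
  exact this.congr fun z hz => h.patchMeanCurvature_eq hz

theorem patchNormal_point (hz : z ∈ Ω) : patchNormal c U z (U z) = 0 :=
  (h.frame hz).normalProj_point

theorem patchNormal_fst (hz : z ∈ Ω) : patchNormal c U z (∂₁ U z) = 0 :=
  (h.frame hz).normalProj_fst

theorem patchNormal_snd (hz : z ∈ Ω) : patchNormal c U z (∂₂ U z) = 0 :=
  (h.frame hz).normalProj_snd

end IsConformalPatch

end Patch

/-! ### The equations of Codazzi and Ricci -/

section Codazzi

variable {n : ℕ} {c : ℝ} {U : ℂ → FlatAmbient n} {Ω : Set ℂ} {z : ℂ}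

theorem planeDeriv_eq_re_im {F : Type*} [NormedAddCommGroup F] [NormedSpace ℝ F] (f : ℂ → F)
    (v z : ℂ) : planeDeriv v f z = v.re • ∂₁ f z + v.im • ∂₂ f z := by
  simp only [planeDeriv]
  rw [← map_smul, ← map_smul, ← map_add]
  congr 1
  apply Complex.ext <;> simp

namespace IsConformalPatch

variable (h : IsConformalPatch c U Ω)
include h

theorem conormalForm_deriv_normal {ξ : ℂ → FlatAmbient n} (hξ : IsPatchNormalField c U Ω ξ)
    (hz : z ∈ Ω) (v : ℂ) : conormalForm c (U z) (planeDeriv v ξ z) = 0 := by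
  rw [h.conormalForm_deriv_of_tangent hξ.smooth (fun w hw => (hξ.normal w hw).tangent) hz v,
    planeDeriv_eq_re_im U v z, ambForm_add_left, ambForm_smul_left, ambForm_smul_left,
    ambForm_comm (∂₁ U z), ambForm_comm (∂₂ U z), (hξ.normal z hz).orth_fst,
    (hξ.normal z hz).orth_snd]
  ring

/-- Weingarten formula: differentiating `⟨ξ, ∂ⱼU⟩ = 0` turns the tangential part of `∂ᵥξ` into
second derivatives of `U`. -/
theorem patchNormal_deriv_normal {ξ : ℂ → FlatAmbient n} (hξ : IsPatchNormalField c U Ω ξ)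
    (hz : z ∈ Ω) (v : ℂ) : patchNormal c U z (planeDeriv v ξ z) =
      planeDeriv v ξ z
        + (ambForm c (ξ z) (planeDeriv v (∂₁ U) z) / confFactor c U z) • ∂₁ U z
        + (ambForm c (ξ z) (planeDeriv v (∂₂ U) z) / confFactor c U z) • ∂₂ U z := by
  have hd := hξ.smooth.differentiableAt_of_isOpen h.isOpen hz
  have e1 := planeDeriv_ambForm (c := c) (v := v) hd (h.diffAt_deriv hz 1)
  rw [planeDeriv_congr (g := fun _ => (0 : ℝ)) h.isOpen
    (fun w hw => (hξ.normal w hw).orth_fst) hz, planeDeriv_const] at e1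
  have e2 := planeDeriv_ambForm (c := c) (v := v) hd (h.diffAt_deriv hz Complex.I)
  rw [planeDeriv_congr (g := fun _ => (0 : ℝ)) h.isOpen
    (fun w hw => (hξ.normal w hw).orth_snd) hz, planeDeriv_const] at e2
  rw [patchNormal, normalProj_apply,
    tangentProj_of_tangent (h.conormalForm_deriv_normal hξ hz v), ← h.norm_eq z hz,
    show ambForm c (planeDeriv v ξ z) (∂₁ U z) = -ambForm c (ξ z) (planeDeriv v (∂₁ U) z) by
      linarith,
    show ambForm c (planeDeriv v ξ z) (∂₂ U z) = -ambForm c (ξ z) (planeDeriv v (∂₂ U) z) by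
      linarith, confFactor]
  module

/-- The normal connection is metric. -/
theorem planeDeriv_ambForm_normal {ξ η : ℂ → FlatAmbient n} (hξ : IsPatchNormalField c U Ω ξ)
    (hη : IsPatchNormalField c U Ω η) (hz : z ∈ Ω) (v : ℂ) :
    planeDeriv v (fun w => ambForm c (ξ w) (η w)) z =
      ambForm c (patchNormal c U z (planeDeriv v ξ z)) (η z) +
        ambForm c (ξ z) (patchNormal c U z (planeDeriv v η z)) := by
  rw [planeDeriv_ambForm (hξ.smooth.differentiableAt_of_isOpen h.isOpen hz)
    (hη.smooth.differentiableAt_of_isOpen h.isOpen hz), patchNormal,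
    (hη.normal z hz).ambForm_normalProj (h.conormalForm_deriv_normal hξ hz v),
    ambForm_comm (ξ z) (normalProj _ _ _ _ _),
    (hξ.normal z hz).ambForm_normalProj (h.conormalForm_deriv_normal hη hz v),
    ambForm_comm (ξ z)]

theorem patchNormal_deriv_hopfRe (hz : z ∈ Ω) (v : ℂ) :
    patchNormal c U z (planeDeriv v (hopfRe c U) z) =
      patchNormal c U z (planeDeriv v (∂₁ (∂₁ U)) z)
        - patchNormal c U z (planeDeriv v (∂₂ (∂₂ U)) z)
        - confLogDeriv c U 1 z • patchNormal c U z (planeDeriv v (∂₁ U) z)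
        + confLogDeriv c U Complex.I z • patchNormal c U z (planeDeriv v (∂₂ U) z) := by
  have d1 := ((h.smooth_deriv 1).planeDeriv h.isOpen 1).differentiableAt_of_isOpen h.isOpen hz
  have d2 := ((h.smooth_deriv Complex.I).planeDeriv h.isOpen Complex.I).differentiableAt_of_isOpen
    h.isOpen hz
  have l1 := (h.smooth_confLogDeriv 1).differentiableAt_of_isOpen h.isOpen hz
  have l2 := (h.smooth_confLogDeriv Complex.I).differentiableAt_of_isOpen h.isOpen hz
  have u1 := h.diffAt_deriv hz 1
  have u2 := h.diffAt_deriv hz Complex.I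
  have e : planeDeriv v (hopfRe c U) z = _ :=
    planeDeriv_add (v := v) ((d1.fun_sub d2).fun_sub (l1.fun_smul u1)) (l2.fun_smul u2)
  rw [e, planeDeriv_sub (d1.fun_sub d2) (l1.fun_smul u1), planeDeriv_sub d1 d2,
    planeDeriv_smul l1 u1, planeDeriv_smul l2 u2]
  simp only [map_add, map_sub, map_smul, h.patchNormal_fst hz, h.patchNormal_snd hz, smul_zero,
    add_zero]

theorem patchNormal_deriv_hopfIm (hz : z ∈ Ω) (v : ℂ) :
    patchNormal c U z (planeDeriv v (hopfIm c U) z) =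
      (2 : ℝ) • patchNormal c U z (planeDeriv v (∂₁ (∂₂ U)) z)
        - confLogDeriv c U Complex.I z • patchNormal c U z (planeDeriv v (∂₁ U) z)
        - confLogDeriv c U 1 z • patchNormal c U z (planeDeriv v (∂₂ U) z) := by
  have d1 := ((h.smooth_deriv Complex.I).planeDeriv h.isOpen 1).differentiableAt_of_isOpen
    h.isOpen hz
  have l1 := (h.smooth_confLogDeriv 1).differentiableAt_of_isOpen h.isOpen hz
  have l2 := (h.smooth_confLogDeriv Complex.I).differentiableAt_of_isOpen h.isOpen hz
  have u1 := h.diffAt_deriv hz 1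
  have u2 := h.diffAt_deriv hz Complex.I
  have e : planeDeriv v (hopfIm c U) z = _ :=
    planeDeriv_sub (v := v) ((d1.fun_const_smul (2 : ℝ)).fun_sub (l2.fun_smul u1))
      (l1.fun_smul u2)
  rw [e, planeDeriv_sub (d1.fun_const_smul (2 : ℝ)) (l2.fun_smul u1), planeDeriv_const_smul 2 d1,
    planeDeriv_smul l2 u1, planeDeriv_smul l1 u2]
  simp only [map_add, map_sub, map_smul, h.patchNormal_fst hz, h.patchNormal_snd hz, smul_zero,
    add_zero]

end IsConformalPatch

namespace IsParallelFlatPatch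

variable (h : IsParallelFlatPatch c U Ω)
include h

/-- Parallelism of `H` enters here: in the normal part of the differentiated `laplacian_eq` the
derivative of `H`, the derivative of `U` and `U` itself all disappear, so only the derivative of the
conformal factor survives. -/
theorem patchNormal_deriv_laplacian (hz : z ∈ Ω) (v : ℂ) :
    patchNormal c U z (planeDeriv v (∂₁ (∂₁ U)) z)
        + patchNormal c U z (planeDeriv v (∂₂ (∂₂ U)) z) =
      confLogDeriv c U v z •
        (patchNormal c U z (∂₁ (∂₁ U) z) + patchNormal c U z (∂₂ (∂₂ U) z)) := by
  have hc := h.toIsConformalPatch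
  have d1 := ((hc.smooth_deriv 1).planeDeriv h.isOpen 1).differentiableAt_of_isOpen h.isOpen hz
  have d2 := ((hc.smooth_deriv Complex.I).planeDeriv h.isOpen
    Complex.I).differentiableAt_of_isOpen h.isOpen hz
  have dl := hc.smooth_confFactor.differentiableAt_of_isOpen h.isOpen hz
  have dH := hc.smooth_patchMeanCurvature.differentiableAt_of_isOpen h.isOpen hz
  have dU := hc.diffAt hz
  have dl2 : DifferentiableAt ℝ (fun z => 2 * confFactor c U z) z := dl.const_mul 2
  have e := planeDeriv_congr (v := v) h.isOpen (fun w hw => hc.laplacian_eq hw) hz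
  rw [planeDeriv_add d1 d2, planeDeriv_smul dl2 (dH.fun_sub (dU.fun_const_smul c)),
    planeDeriv_sub dH (dU.fun_const_smul c), planeDeriv_const_smul c dU,
    show planeDeriv v (fun z => 2 * confFactor c U z) z = 2 * planeDeriv v (confFactor c U) z from
      planeDeriv_const_smul (2 : ℝ) dl] at e
  have hUv : patchNormal c U z (planeDeriv v U z) = 0 := by
    rw [planeDeriv_eq_re_im U v z, map_add, map_smul, map_smul, hc.patchNormal_fst hz,
      hc.patchNormal_snd hz, smul_zero, smul_zero, add_zero]
  rw [← map_add, ← map_add, e, hc.laplacian_eq hz]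
  simp only [map_add, map_sub, map_smul, h.parallel z hz v, hUv, hc.patchNormal_point hz,
    smul_zero, sub_zero, zero_add]
  have hne : confFactor c U z ≠ 0 := h.norm_ne z hz
  rw [smul_smul, confLogDeriv]
  congr 1
  field_simp

/-- Third derivatives of `U` commute and `patchNormal_deriv_laplacian` trades `∂₁∂₁` for `-∂₂∂₂`.
Together with `codazzi_snd` this says that `hopfRe - i hopfIm` is holomorphic for the normal
connection. -/
theorem codazzi_fst (hz : z ∈ Ω) : patchNormal c U z (∂₁ (hopfRe c U) z) =
    -patchNormal c U z (∂₂ (hopfIm c U) z) := by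
  have hc := h.toIsConformalPatch
  have e := h.patchNormal_deriv_laplacian hz 1
  rw [hc.patchNormal_deriv_hopfRe hz, hc.patchNormal_deriv_hopfIm hz, hc.deriv_comm hz,
    planeDeriv_comm h.isOpen (hc.smooth_deriv Complex.I) hz Complex.I 1,
    eq_sub_of_add_eq e]
  module

theorem codazzi_snd (hz : z ∈ Ω) : patchNormal c U z (∂₂ (hopfRe c U) z) =
    patchNormal c U z (∂₁ (hopfIm c U) z) := by
  have hc := h.toIsConformalPatch
  have e := h.patchNormal_deriv_laplacian hz Complex.I
  have e2 : ∂₁ (∂₁ (∂₂ U)) z = ∂₂ (∂₁ (∂₁ U)) z := by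
    rw [← planeDeriv_comm h.isOpen (hc.smooth_deriv 1) hz 1 Complex.I]
    exact planeDeriv_congr h.isOpen (fun w hw => (hc.deriv_comm hw).symm) hz
  rw [hc.patchNormal_deriv_hopfRe hz, hc.patchNormal_deriv_hopfIm hz, hc.deriv_comm hz, e2,
    eq_sub_of_add_eq' e]
  module

/-- By Weingarten and the symmetry of second flat derivatives, `R^⊥ξ = 0` reduces to the symmetry of
`A(∂ᵥ, A_ξ ∂ₖ)` in the two directions. For normal `ξ` this forces the two Hopf parts to be parallel.
-/
theorem ricci {ξ : ℂ → FlatAmbient n} (hξ : IsPatchNormalField c U Ω ξ) (hz : z ∈ Ω) :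
    ambForm c (ξ z) (hopfIm c U z) • hopfRe c U z =
      ambForm c (ξ z) (hopfRe c U z) • hopfIm c U z := by
  have hc := h.toIsConformalPatch
  have hne : confFactor c U z ≠ 0 := h.norm_ne z hz
  have key : ∀ v k : ℂ, patchNormal c U z
      (planeDeriv v (fun w => patchNormal c U w (planeDeriv k ξ w)) z) =
      patchNormal c U z (planeDeriv v (planeDeriv k ξ) z)
        + (ambForm c (ξ z) (planeDeriv k (∂₁ U) z) / confFactor c U z) •
          patchNormal c U z (planeDeriv v (∂₁ U) z)
        + (ambForm c (ξ z) (planeDeriv k (∂₂ U) z) / confFactor c U z) •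
          patchNormal c U z (planeDeriv v (∂₂ U) z) := by
    intro v k
    have dξ := (hξ.smooth.planeDeriv h.isOpen k).differentiableAt_of_isOpen h.isOpen hz
    have df : ∀ j : ℂ, DifferentiableAt ℝ (fun w =>
        ambForm c (ξ w) (planeDeriv k (planeDeriv j U) w) / confFactor c U w) z := fun j =>
      ((hξ.smooth.ambForm ((hc.smooth_deriv j).planeDeriv h.isOpen k)).div hc.smooth_confFactor
        h.norm_ne).differentiableAt_of_isOpen h.isOpen hz
    have u1 := hc.diffAt_deriv hz 1
    have u2 := hc.diffAt_deriv hz Complex.I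
    rw [planeDeriv_congr h.isOpen (fun w hw => hc.patchNormal_deriv_normal hξ hw k) hz,
      planeDeriv_add (dξ.fun_add ((df 1).fun_smul u1)) ((df Complex.I).fun_smul u2),
      planeDeriv_add dξ ((df 1).fun_smul u1), planeDeriv_smul (df 1) u1,
      planeDeriv_smul (df Complex.I) u2]
    simp only [map_add, map_smul, hc.patchNormal_fst hz, hc.patchNormal_snd hz, smul_zero,
      add_zero]
  have e := h.flat ξ hξ z hz
  rw [key, key, planeDeriv_comm h.isOpen hξ.smooth hz 1 Complex.I, hc.deriv_comm hz] at e
  have hξz := hξ.normal z hz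
  have f1 : ambForm c (ξ z) (hopfIm c U z) = 2 * ambForm c (ξ z) (∂₁ (∂₂ U) z) := by
    rw [hopfIm]
    simp only [ambForm_sub_right, ambForm_smul_right, hξz.orth_fst, hξz.orth_snd]
    ring
  have f2 : ambForm c (ξ z) (hopfRe c U z) =
      ambForm c (ξ z) (∂₁ (∂₁ U) z) - ambForm c (ξ z) (∂₂ (∂₂ U) z) := by
    rw [hopfRe]
    simp only [ambForm_sub_right, ambForm_add_right, ambForm_smul_right, hξz.orth_fst,
      hξz.orth_snd]
    ring
  rw [f1, f2, ← hc.patchNormal_fst_fst_sub hz, ← hc.two_smul_patchNormal_fst_snd hz]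
  set p := ambForm c (ξ z) (∂₁ (∂₁ U) z)
  set q := ambForm c (ξ z) (∂₁ (∂₂ U) z)
  set r := ambForm c (ξ z) (∂₂ (∂₂ U) z)
  set l := confFactor c U z
  -- Apart from a common term, `e` is `q A₁₁ + r A₁₂ = p A₁₂ + q A₂₂` divided by `l`.
  have e' := congrArg (fun X => (2 * l) • X) e
  simp only [smul_add, smul_smul] at e'
  rw [show 2 * l * (q / l) = 2 * q by field_simp, show 2 * l * (r / l) = 2 * r by field_simp,
    show 2 * l * (p / l) = 2 * p by field_simp] at e'
  linear_combination (norm := module) e'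

end IsParallelFlatPatch

end Codazzi

/-! ### The quartic differential and the linear system of a patch -/

section Quartic

variable {n : ℕ} {c : ℝ} {U : ℂ → FlatAmbient n} {Ω : Set ℂ} {z : ℂ}

/-- The holomorphic quartic differential `⟨φ, φ⟩` of the vector valued Hopf differential `φ`. -/
noncomputable def hopfQuartic (c : ℝ) (U : ℂ → FlatAmbient n) (z : ℂ) : ℂ :=
  ⟨ambForm c (hopfRe c U z) (hopfRe c U z) - ambForm c (hopfIm c U z) (hopfIm c U z),
    -2 * ambForm c (hopfRe c U z) (hopfIm c U z)⟩

/-- The fields whose linear system governs the patch. -/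
noncomputable def patchFields (c : ℝ) (U : ℂ → FlatAmbient n) : Fin 6 → ℂ → FlatAmbient n :=
  ![U, ∂₁ U, ∂₂ U, patchMeanCurvature c U, hopfRe c U, hopfIm c U]

/-- A vector differs from its normal part by a combination of `U`, `∂₁U`, `∂₂U` with continuous
coefficients, so only normal parts need to be controlled. -/
theorem IsConformalPatch.contSpan_deriv (h : IsConformalPatch c U Ω) {Ω' : Set ℂ} (hsub : Ω' ⊆ Ω)
    {f : ℂ → FlatAmbient n} (hf : ContDiffOn ℝ ∞ f Ω) (v : ℂ)
    (hN : ContSpan (patchFields c U) Ω' (fun z => patchNormal c U z (planeDeriv v f z))) :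
    ContSpan (patchFields c U) Ω' (planeDeriv v f) := by
  have hd := hf.planeDeriv h.isOpen v
  have hQ : ContinuousOn (fun z => conormalForm c (U z) (planeDeriv v f z)) Ω :=
    (h.smooth.continuousOn.fst.mul hd.continuousOn.fst).add
      (continuousOn_const.mul (h.smooth.continuousOn.snd.inner hd.continuousOn.snd))
  have hT : ContinuousOn (fun z => tangentProj c (U z) (planeDeriv v f z)) Ω :=
    hd.continuousOn.sub (hQ.smul h.smooth.continuousOn)
  have hm : ∀ k, ContinuousOn (fun z => ambForm c (tangentProj c (U z) (planeDeriv v f z))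
      (planeDeriv k U z) / confFactor c U z) Ω := fun k =>
    ((continuousOn_const.mul (hT.fst.mul (h.smooth_deriv k).continuousOn.fst)).add
      (hT.snd.inner (h.smooth_deriv k).continuousOn.snd)).div
        h.smooth_confFactor.continuousOn h.norm_ne
  have hX : ∀ i, ContSpan (patchFields c U) Ω' (patchFields c U i) := fun i => ContSpan.single i
  refine (((hN.add ((hX 0).smul (hQ.mono hsub))).add ((hX 1).smul ((hm 1).mono hsub))).add
    ((hX 2).smul ((hm Complex.I).mono hsub))).congr fun z hz => ?_
  simp only [patchFields, Matrix.cons_val, patchNormal, normalProj_apply, tangentProj]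
  rw [← h.norm_eq z (hsub hz), confFactor]
  module

namespace IsParallelFlatPatch

variable (h : IsParallelFlatPatch c U Ω)
include h

theorem hopf_parallel (hz : z ∈ Ω) :
    ambForm c (hopfIm c U z) (hopfIm c U z) • hopfRe c U z =
      ambForm c (hopfRe c U z) (hopfIm c U z) • hopfIm c U z := by
  rw [h.ricci h.isPatchNormalField_hopfIm hz, ambForm_comm]

theorem hopf_parallel' (hz : z ∈ Ω) :
    ambForm c (hopfRe c U z) (hopfRe c U z) • hopfIm c U z =
      ambForm c (hopfRe c U z) (hopfIm c U z) • hopfRe c U z :=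
  parallel_symm (h.mem z hz) (h.isPatchNormalField_hopfIm.normal z hz) (h.hopf_parallel hz)

theorem hopf_eq_zero_of_add_eq_zero (hz : z ∈ Ω) (h0 : ambForm c (hopfRe c U z) (hopfRe c U z) +
    ambForm c (hopfIm c U z) (hopfIm c U z) = 0) : hopfRe c U z = 0 ∧ hopfIm c U z = 0 := by
  have h1 := h.isPatchNormalField_hopfRe.normal z hz
  have h2 := h.isPatchNormalField_hopfIm.normal z hz
  have p1 := h1.ambForm_nonneg (h.mem z hz)
  have p2 := h2.ambForm_nonneg (h.mem z hz)
  exact ⟨h1.eq_zero_of_ambForm (h.mem z hz) (by linarith),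
    h2.eq_zero_of_ambForm (h.mem z hz) (by linarith)⟩

/-- For parallel real and imaginary parts nothing cancels in `⟨φ,φ⟩`: its modulus is `|hopfRe|² +
|hopfIm|²`. -/
theorem add_eq_zero_of_hopfQuartic (hz : z ∈ Ω) (h0 : hopfQuartic c U z = 0) :
    ambForm c (hopfRe c U z) (hopfRe c U z) + ambForm c (hopfIm c U z) (hopfIm c U z) = 0 := by
  have e1 : ambForm c (hopfRe c U z) (hopfRe c U z) - ambForm c (hopfIm c U z) (hopfIm c U z) = 0 :=
    congrArg Complex.re h0
  have e2 : -2 * ambForm c (hopfRe c U z) (hopfIm c U z) = 0 := congrArg Complex.im h0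
  have e3 := congrArg (fun X => ambForm c X (hopfRe c U z)) (h.hopf_parallel hz)
  simp only [ambForm_smul_left] at e3
  rw [show ambForm c (hopfRe c U z) (hopfIm c U z) = 0 by linarith, zero_mul] at e3
  rcases mul_eq_zero.1 e3 with e | e <;> linarith

/-- The normal connection is metric and `φ` is holomorphic for it by Codazzi, so the product rule
yields the Cauchy-Riemann equation. -/
theorem differentiableOn_hopfQuartic : DifferentiableOn ℂ (hopfQuartic c U) Ω := by
  intro z hz
  have hα := h.isPatchNormalField_hopfRe
  have hγ := h.isPatchNormalField_hopfIm
  have daa := (hα.smooth.ambForm (c := c) hα.smooth).differentiableAt_of_isOpen h.isOpen hz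
  have dag := (hα.smooth.ambForm (c := c) hγ.smooth).differentiableAt_of_isOpen h.isOpen hz
  have dgg := (hγ.smooth.ambForm (c := c) hγ.smooth).differentiableAt_of_isOpen h.isOpen hz
  have e : hopfQuartic c U = fun w => (ambForm c (hopfRe c U w) (hopfRe c U w) -
      ambForm c (hopfIm c U w) (hopfIm c U w)) • (1 : ℂ) +
      (ambForm c (hopfRe c U w) (hopfIm c U w)) • (-2 * Complex.I) := by
    funext w
    apply Complex.ext <;> simp [hopfQuartic]
    ring
  have d1 : DifferentiableAt ℝ (fun w => (ambForm c (hopfRe c U w) (hopfRe c U w) -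
      ambForm c (hopfIm c U w) (hopfIm c U w)) • (1 : ℂ)) z :=
    (daa.fun_sub dgg).fun_smul (differentiableAt_const _)
  have d2 : DifferentiableAt ℝ (fun w => (ambForm c (hopfRe c U w) (hopfIm c U w)) •
      (-2 * Complex.I)) z := dag.fun_smul (differentiableAt_const _)
  have key : ∀ v, planeDeriv v (hopfQuartic c U) z =
      (2 * ambForm c (patchNormal c U z (planeDeriv v (hopfRe c U) z)) (hopfRe c U z) -
        2 * ambForm c (patchNormal c U z (planeDeriv v (hopfIm c U) z)) (hopfIm c U z)) • (1 : ℂ) +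
      (ambForm c (patchNormal c U z (planeDeriv v (hopfRe c U) z)) (hopfIm c U z) +
        ambForm c (patchNormal c U z (planeDeriv v (hopfIm c U) z)) (hopfRe c U z)) •
          (-2 * Complex.I) := by
    intro v
    rw [e, planeDeriv_add d1 d2, planeDeriv_smul (daa.fun_sub dgg) (differentiableAt_const _),
      planeDeriv_smul dag (differentiableAt_const _), planeDeriv_sub daa dgg,
      h.planeDeriv_ambForm_normal hα hα hz, h.planeDeriv_ambForm_normal hα hγ hz,
      h.planeDeriv_ambForm_normal hγ hγ hz, planeDeriv_const, planeDeriv_const,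
      ambForm_comm (hopfRe c U z) (patchNormal c U z (planeDeriv v (hopfRe c U) z)),
      ambForm_comm (hopfIm c U z) (patchNormal c U z (planeDeriv v (hopfIm c U) z)),
      ambForm_comm (hopfRe c U z) (patchNormal c U z (planeDeriv v (hopfIm c U) z))]
    module
  refine DifferentiableAt.differentiableWithinAt
    (differentiableAt_complex_iff_differentiableAt_real.2 ⟨e ▸ d1.fun_add d2, ?_⟩)
  change ∂₂ (hopfQuartic c U) z = Complex.I • ∂₁ (hopfQuartic c U) z
  rw [key, key, h.codazzi_fst hz, h.codazzi_snd hz]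
  simp only [← neg_one_smul ℝ (patchNormal c U z (∂₂ (hopfIm c U) z)), ambForm_smul_left]
  apply Complex.ext <;> simp <;> ring

/-- The normal part of the differentiated relation `hopf_parallel`. With its primed companion and
Codazzi it can be solved for the normal derivatives of the Hopf parts. -/
theorem patchNormal_deriv_parallel (hz : z ∈ Ω) (v : ℂ) :
    ambForm c (hopfIm c U z) (hopfIm c U z) • patchNormal c U z (planeDeriv v (hopfRe c U) z)
      + planeDeriv v (fun w => ambForm c (hopfIm c U w) (hopfIm c U w)) z • hopfRe c U z =
    ambForm c (hopfRe c U z) (hopfIm c U z) • patchNormal c U z (planeDeriv v (hopfIm c U) z)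
      + planeDeriv v (fun w => ambForm c (hopfRe c U w) (hopfIm c U w)) z • hopfIm c U z := by
  have hα := h.isPatchNormalField_hopfRe
  have hγ := h.isPatchNormalField_hopfIm
  have dag := (hα.smooth.ambForm (c := c) hγ.smooth).differentiableAt_of_isOpen h.isOpen hz
  have dgg := (hγ.smooth.ambForm (c := c) hγ.smooth).differentiableAt_of_isOpen h.isOpen hz
  have dα := hα.smooth.differentiableAt_of_isOpen h.isOpen hz
  have dγ := hγ.smooth.differentiableAt_of_isOpen h.isOpen hz
  have e := planeDeriv_congr (v := v) h.isOpen (fun w hw => h.hopf_parallel hw) hz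
  rw [planeDeriv_smul dgg dα, planeDeriv_smul dag dγ] at e
  have eN := congrArg (patchNormal c U z) e
  simp only [map_add, map_smul] at eN
  rwa [show patchNormal c U z (hopfRe c U z) = _ from (hα.normal z hz).normalProj_eq,
    show patchNormal c U z (hopfIm c U z) = _ from (hγ.normal z hz).normalProj_eq] at eN

theorem patchNormal_deriv_parallel' (hz : z ∈ Ω) (v : ℂ) :
    ambForm c (hopfRe c U z) (hopfRe c U z) • patchNormal c U z (planeDeriv v (hopfIm c U) z)
      + planeDeriv v (fun w => ambForm c (hopfRe c U w) (hopfRe c U w)) z • hopfIm c U z =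
    ambForm c (hopfRe c U z) (hopfIm c U z) • patchNormal c U z (planeDeriv v (hopfRe c U) z)
      + planeDeriv v (fun w => ambForm c (hopfRe c U w) (hopfIm c U w)) z • hopfRe c U z := by
  have hα := h.isPatchNormalField_hopfRe
  have hγ := h.isPatchNormalField_hopfIm
  have dag := (hα.smooth.ambForm (c := c) hγ.smooth).differentiableAt_of_isOpen h.isOpen hz
  have daa := (hα.smooth.ambForm (c := c) hα.smooth).differentiableAt_of_isOpen h.isOpen hz
  have dα := hα.smooth.differentiableAt_of_isOpen h.isOpen hz
  have dγ := hγ.smooth.differentiableAt_of_isOpen h.isOpen hz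
  have e := planeDeriv_congr (v := v) h.isOpen (fun w hw => h.hopf_parallel' hw) hz
  rw [planeDeriv_smul daa dγ, planeDeriv_smul dag dα] at e
  have eN := congrArg (patchNormal c U z) e
  simp only [map_add, map_smul] at eN
  rwa [show patchNormal c U z (hopfRe c U z) = _ from (hα.normal z hz).normalProj_eq,
    show patchNormal c U z (hopfIm c U z) = _ from (hγ.normal z hz).normalProj_eq] at eN

/-- Off the zeros of the Hopf differential its normal derivatives are multiples of itself. -/
theorem contSpan_patchNormal_hopf {Ω' : Set ℂ} (hsub : Ω' ⊆ Ω)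
    (hs : ∀ z ∈ Ω', ambForm c (hopfRe c U z) (hopfRe c U z) +
      ambForm c (hopfIm c U z) (hopfIm c U z) ≠ 0) :
    ContSpan (patchFields c U) Ω' (fun z => patchNormal c U z (∂₁ (hopfRe c U) z)) ∧
      ContSpan (patchFields c U) Ω' (fun z => patchNormal c U z (∂₁ (hopfIm c U) z)) := by
  have hα := h.isPatchNormalField_hopfRe.smooth
  have hγ := h.isPatchNormalField_hopfIm.smooth
  have caa := hα.ambForm (c := c) hα
  have cag := hα.ambForm (c := c) hγ
  have cgg := hγ.ambForm (c := c) hγ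
  have ci : ContinuousOn (fun z => (ambForm c (hopfRe c U z) (hopfRe c U z) +
      ambForm c (hopfIm c U z) (hopfIm c U z))⁻¹) Ω' :=
    ((caa.continuousOn.mono hsub).add (cgg.continuousOn.mono hsub)).inv₀ hs
  have cd : ∀ {f : ℂ → ℝ}, ContDiffOn ℝ ∞ f Ω → ∀ v, ContinuousOn (planeDeriv v f) Ω' :=
    fun hf v => (hf.planeDeriv h.isOpen v).continuousOn.mono hsub
  have hX : ∀ i, ContSpan (patchFields c U) Ω' (patchFields c U i) := fun i => ContSpan.single i
  constructor
  · refine ((((hX 5).smul ((cd cag 1).add (cd caa Complex.I))).add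
      ((hX 4).smul ((cd cgg 1).neg.sub (cd cag Complex.I)))).smul ci).congr fun z hz => ?_
    have hz' := hsub hz
    rw [eq_inv_smul_iff₀ (hs z hz)]
    -- Codazzi rewrites the second relation in `∂₁`-derivatives. In the difference the derivative of
    -- `hopfIm` cancels, and that of `hopfRe` has the nonzero coefficient `|hopfRe|² + |hopfIm|²`.
    have e1 := h.patchNormal_deriv_parallel hz' 1
    have e2 := h.patchNormal_deriv_parallel' hz' Complex.I
    rw [h.codazzi_snd hz'] at e2
    rw [show patchNormal c U z (∂₂ (hopfIm c U) z) = -patchNormal c U z (∂₁ (hopfRe c U) z) by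
      rw [h.codazzi_fst hz', neg_neg]] at e2
    simp only [patchFields, Matrix.cons_val, Pi.add_apply, Pi.sub_apply, Pi.neg_apply]
    linear_combination (norm := module) e1 - e2
  · refine ((((hX 5).smul ((cd cag Complex.I).sub (cd caa 1))).add
      ((hX 4).smul ((cd cag 1).sub (cd cgg Complex.I)))).smul ci).congr fun z hz => ?_
    have hz' := hsub hz
    rw [eq_inv_smul_iff₀ (hs z hz)]
    have e1 := h.patchNormal_deriv_parallel hz' Complex.I
    have e2 := h.patchNormal_deriv_parallel' hz' 1
    rw [h.codazzi_snd hz'] at e1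
    rw [show patchNormal c U z (∂₂ (hopfIm c U) z) = -patchNormal c U z (∂₁ (hopfRe c U) z) by
      rw [h.codazzi_fst hz', neg_neg]] at e1
    simp only [patchFields, Matrix.cons_val, Pi.sub_apply]
    linear_combination (norm := module) e1 + e2

theorem contSpan_patchNormal_hopf_of_eq_zero {Ω' : Set ℂ} (hop : IsOpen Ω') (hsub : Ω' ⊆ Ω)
    (hs : ∀ z ∈ Ω', ambForm c (hopfRe c U z) (hopfRe c U z) +
      ambForm c (hopfIm c U z) (hopfIm c U z) = 0) :
    ContSpan (patchFields c U) Ω' (fun z => patchNormal c U z (∂₁ (hopfRe c U) z)) ∧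
      ContSpan (patchFields c U) Ω' (fun z => patchNormal c U z (∂₁ (hopfIm c U) z)) := by
  refine ⟨ContSpan.zero.congr fun z hz => ?_, ContSpan.zero.congr fun z hz => ?_⟩
  · rw [planeDeriv_congr (g := fun _ => 0) hop
      (fun w hw => (h.hopf_eq_zero_of_add_eq_zero (hsub hw) (hs w hw)).1) hz, planeDeriv_const,
      map_zero]
  · rw [planeDeriv_congr (g := fun _ => 0) hop
      (fun w hw => (h.hopf_eq_zero_of_add_eq_zero (hsub hw) (hs w hw)).2) hz, planeDeriv_const,
      map_zero]

theorem smooth_patchFields (i : Fin 6) : ContDiffOn ℝ ∞ (patchFields c U i) Ω := by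
  fin_cases i
  · exact h.smooth
  · exact h.smooth_deriv 1
  · exact h.smooth_deriv _
  · exact h.smooth_patchMeanCurvature
  · exact h.smooth_hopfRe
  · exact h.smooth_hopfIm

/-- The fields of the patch solve a linear system where the Hopf differential is controlled. -/
theorem contSpan_deriv_patchFields {Ω' : Set ℂ} (hsub : Ω' ⊆ Ω)
    (hα : ContSpan (patchFields c U) Ω' (fun z => patchNormal c U z (∂₁ (hopfRe c U) z)))
    (hγ : ContSpan (patchFields c U) Ω' (fun z => patchNormal c U z (∂₁ (hopfIm c U) z)))
    (i : Fin 6) : ContSpan (patchFields c U) Ω' (∂₁ (patchFields c U i)) ∧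
      ContSpan (patchFields c U) Ω' (∂₂ (patchFields c U i)) := by
  have hc := h.toIsConformalPatch
  have hX : ∀ i, ContSpan (patchFields c U) Ω' (patchFields c U i) := fun i => ContSpan.single i
  have cl : ContinuousOn (confFactor c U) Ω' := hc.smooth_confFactor.continuousOn.mono hsub
  have hne : ∀ z ∈ Ω', confFactor c U z ≠ 0 := fun z hz => h.norm_ne z (hsub hz)
  -- The sum `A₁₁ + A₂₂` is a multiple of `H` and the difference is `hopfRe`, so each of the two is
  -- a combination of the fields.
  have hsum : ∀ z ∈ Ω', (2 * confFactor c U z) • patchMeanCurvature c U z =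
      patchNormal c U z (∂₁ (∂₁ U) z) + patchNormal c U z (∂₂ (∂₂ U) z) := by
    intro z hz
    have := hne z hz
    rw [patchMeanCurvature, ← h.norm_eq z (hsub hz),
      show ambForm c (∂₁ U z) (∂₁ U z) = confFactor c U z from rfl, ← smul_add, smul_smul,
      smul_smul, show 2 * confFactor c U z * (1 / 2) * (confFactor c U z)⁻¹ = 1 by field_simp,
      one_smul]
  have h11 : ContSpan (patchFields c U) Ω' (fun z => patchNormal c U z (∂₁ (∂₁ U) z)) := by
    refine (((hX 3).smul cl).add ((hX 4).smul (a := fun _ => 1 / 2)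
      continuousOn_const)).congr fun z hz => ?_
    simp only [patchFields, Matrix.cons_val]
    rw [← hc.patchNormal_fst_fst_sub (hsub hz)]
    linear_combination (norm := module) (-1 / 2 : ℝ) • hsum z hz
  have h22 : ContSpan (patchFields c U) Ω' (fun z => patchNormal c U z (∂₂ (∂₂ U) z)) := by
    refine (((hX 3).smul cl).add ((hX 4).smul (a := fun _ => -1 / 2)
      continuousOn_const)).congr fun z hz => ?_
    simp only [patchFields, Matrix.cons_val]
    rw [← hc.patchNormal_fst_fst_sub (hsub hz)]
    linear_combination (norm := module) (-1 / 2 : ℝ) • hsum z hz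
  have h12 : ContSpan (patchFields c U) Ω' (fun z => patchNormal c U z (∂₁ (∂₂ U) z)) := by
    refine ((hX 5).smul (a := fun _ => 1 / 2) continuousOn_const).congr fun z hz => ?_
    simp only [patchFields, Matrix.cons_val]
    rw [← hc.two_smul_patchNormal_fst_snd (hsub hz)]
    module
  have h21 := h12.congr (g := fun z => patchNormal c U z (∂₂ (∂₁ U) z))
    fun z hz => by rw [hc.deriv_comm (hsub hz)]
  have hH : ∀ v, ContSpan (patchFields c U) Ω'
      (fun z => patchNormal c U z (planeDeriv v (patchMeanCurvature c U) z)) := fun v =>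
    ContSpan.zero.congr fun z hz => h.parallel z (hsub hz) v
  have hα2 := hγ.congr (g := fun z => patchNormal c U z (∂₂ (hopfRe c U) z))
    fun z hz => h.codazzi_snd (hsub hz)
  have hγ2 := (hα.smul (a := fun _ => -1) continuousOn_const).congr
    (g := fun z => patchNormal c U z (∂₂ (hopfIm c U) z))
    fun z hz => by rw [h.codazzi_fst (hsub hz)]; module
  fin_cases i
  · exact ⟨hX 1, hX 2⟩
  · exact ⟨hc.contSpan_deriv hsub (hc.smooth_deriv 1) _ h11,
      hc.contSpan_deriv hsub (hc.smooth_deriv 1) _ h21⟩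
  · exact ⟨hc.contSpan_deriv hsub (hc.smooth_deriv _) _ h12,
      hc.contSpan_deriv hsub (hc.smooth_deriv _) _ h22⟩
  · exact ⟨hc.contSpan_deriv hsub hc.smooth_patchMeanCurvature _ (hH _),
      hc.contSpan_deriv hsub hc.smooth_patchMeanCurvature _ (hH _)⟩
  · exact ⟨hc.contSpan_deriv hsub hc.smooth_hopfRe _ hα,
      hc.contSpan_deriv hsub hc.smooth_hopfRe _ hα2⟩
  · exact ⟨hc.contSpan_deriv hsub hc.smooth_hopfIm _ hγ,
      hc.contSpan_deriv hsub hc.smooth_hopfIm _ hγ2⟩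

/-- Off a countable set the values of the fields at one point determine the patch. -/
theorem exists_countable_propagation (hΩ : IsPreconnected Ω) :
    ∃ C : Set ℂ, C.Countable ∧ ∀ l : FlatAmbient n →L[ℝ] ℝ, ∀ z₀ ∈ Ω \ C,
      (∀ i, l (patchFields c U i z₀) = 0) → ∀ z ∈ Ω, l (U z) = 0 := by
  -- If the quartic differential vanishes identically, so does `φ` and the system is closed on all
  -- of `Ω`; otherwise its countably many zeros are removed.
  by_cases hq : Set.EqOn (hopfQuartic c U) 0 Ω
  · refine ⟨∅, Set.countable_empty, fun l z₀ hz₀ h0 z hz => ?_⟩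
    obtain ⟨hα, hγ⟩ := h.contSpan_patchNormal_hopf_of_eq_zero h.isOpen le_rfl
      fun z hz => h.add_eq_zero_of_hopfQuartic hz (hq hz)
    have hsys := h.contSpan_deriv_patchFields le_rfl hα hγ
    exact eq_zero_of_contSpan h.isOpen hΩ
      (fun i => (h.smooth_patchFields i).differentiableOn (by simp))
      (fun i => (hsys i).1) (fun i => (hsys i).2) l hz₀.1 h0 z hz 0
  · have hd := h.differentiableOn_hopfQuartic
    have hC := countable_zeros_of_differentiableOn h.isOpen hΩ hd hq
    set C := Ω ∩ {z | hopfQuartic c U z = 0} with hCdef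
    have hop : IsOpen (Ω \ C) := by
      have : Ω \ C = Ω ∩ hopfQuartic c U ⁻¹' {0}ᶜ := by
        ext z; simp [hCdef]
      rw [this]
      exact hd.continuousOn.isOpen_inter_preimage h.isOpen isOpen_compl_singleton
    have hsub : Ω \ C ⊆ Ω := Set.sdiff_subset
    refine ⟨C, hC, fun l z₀ hz₀ h0 => ?_⟩
    obtain ⟨hα, hγ⟩ := h.contSpan_patchNormal_hopf hsub fun z hz h0 => by
      obtain ⟨e1, e2⟩ := h.hopf_eq_zero_of_add_eq_zero hz.1 h0
      exact hz.2 ⟨hz.1, by apply Complex.ext <;> simp [hopfQuartic, e1, e2, ambForm]⟩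
    have hsys := h.contSpan_deriv_patchFields hsub hα hγ
    have hzero := eq_zero_of_contSpan hop (hΩ.diff_countable h.isOpen hC)
      (fun i => ((h.smooth_patchFields i).mono hsub).differentiableOn (by simp))
      (fun i => (hsys i).1) (fun i => (hsys i).2) l hz₀ h0
    intro z hz
    -- Density and continuity recover the removed points.
    have hcl : z ∈ closure (Ω \ C) := (hC.dense_compl ℝ).open_subset_closure_inter h.isOpen hz
    have hcont : ContinuousAt (fun w => l (U w)) z :=
      l.continuous.continuousAt.comp (h.diffAt hz).continuousAt
    simpa using hcont.continuousWithinAt.mem_closure hcl (t := {(0 : ℝ)})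
      fun w hw => hzero w hw 0

/-- Each field is, at every point, a combination of `U` and its first and second derivatives, and
these derivatives are killed along with `U` on an open set. -/
theorem functional_patchFields_eq_zero {V : Set ℂ} (hV : IsOpen V) (hsub : V ⊆ Ω)
    (l : FlatAmbient n →L[ℝ] ℝ) (hl : ∀ z ∈ V, l (U z) = 0) (hz : z ∈ V) (i : Fin 6) :
    l (patchFields c U i z) = 0 := by
  have hc := h.toIsConformalPatch
  have step : ∀ f : ℂ → FlatAmbient n, ContDiffOn ℝ ∞ f Ω → (∀ z ∈ V, l (f z) = 0) →
      ∀ v, ∀ z ∈ V, l (planeDeriv v f z) = 0 := by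
    intro f hf h0 v z hz
    have hd := hf.differentiableAt_of_isOpen h.isOpen (hsub hz)
    have e : planeDeriv v (fun w => l (f w)) z = l (planeDeriv v f z) := by
      have := (l.hasFDerivAt.comp z hd.hasFDerivAt).fderiv
      simp only [planeDeriv]
      erw [this]
      rfl
    rw [← e, planeDeriv_congr (g := fun _ => (0 : ℝ)) hV h0 hz, planeDeriv_const]
  have s1 := step U h.smooth hl
  have s2 := fun k => step _ (hc.smooth_deriv k) (s1 k)
  fin_cases i
  · exact hl z hz
  · exact s1 1 z hz
  · exact s1 Complex.I z hz
  · change l (patchMeanCurvature c U z) = 0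
    rw [hc.patchMeanCurvature_eq (hsub hz)]
    simp [s2 _ _ z hz, hl z hz]
  · change l (hopfRe c U z) = 0
    simp [hopfRe, s2 _ _ z hz, s1 _ z hz]
  · change l (hopfIm c U z) = 0
    simp [hopfIm, s2 _ _ z hz, s1 _ z hz]

/-- Unique continuation for the linear functions of a patch. -/
theorem unique_continuation (hΩ : IsPreconnected Ω) {V : Set ℂ} (hV : IsOpen V)
    (hne : V.Nonempty) (hsub : V ⊆ Ω) (l : FlatAmbient n →L[ℝ] ℝ) (hl : ∀ z ∈ V, l (U z) = 0) :
    ∀ z ∈ Ω, l (U z) = 0 := by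
  obtain ⟨C, hC, hprop⟩ := h.exists_countable_propagation hΩ
  obtain ⟨z₀, hz₀, hzC⟩ := (hC.dense_compl ℝ).inter_open_nonempty V hV hne
  exact hprop l z₀ ⟨hsub hz₀, hzC⟩ fun i => h.functional_patchFields_eq_zero hV hsub l hl hz₀ i

/-- A patch lies in a five-dimensional linear subspace. -/
theorem exists_submodule (hΩ : IsPreconnected Ω) (hne : Ω.Nonempty) :
    ∃ W : Submodule ℝ (FlatAmbient n), Module.finrank ℝ W ≤ 5 ∧
      ∀ l : FlatAmbient n →L[ℝ] ℝ, (∀ w ∈ W, l w = 0) → ∀ z ∈ Ω, l (U z) = 0 := by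
  obtain ⟨C, hC, hprop⟩ := h.exists_countable_propagation hΩ
  obtain ⟨z₀, hz₀, hzC⟩ := (hC.dense_compl ℝ).inter_open_nonempty Ω h.isOpen hne
  -- Both Hopf parts are multiples of one vector `ν`, which brings six spanning vectors down to
  -- five.
  obtain ⟨ν, a, b, ha, hb⟩ : ∃ (ν : FlatAmbient n) (a b : ℝ),
      hopfRe c U z₀ = a • ν ∧ hopfIm c U z₀ = b • ν := by
    by_cases h0 : ambForm c (hopfIm c U z₀) (hopfIm c U z₀) = 0
    · refine ⟨hopfRe c U z₀, 1, 0, (one_smul _ _).symm, ?_⟩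
      rw [zero_smul]
      exact (h.isPatchNormalField_hopfIm.normal z₀ hz₀).eq_zero_of_ambForm (h.mem z₀ hz₀) h0
    · refine ⟨hopfIm c U z₀, (ambForm c (hopfIm c U z₀) (hopfIm c U z₀))⁻¹ *
        ambForm c (hopfRe c U z₀) (hopfIm c U z₀), 1, ?_, (one_smul _ _).symm⟩
      rw [mul_smul, ← h.hopf_parallel hz₀, smul_smul, inv_mul_cancel₀ h0, one_smul]
  let Y : Fin 5 → FlatAmbient n := ![U z₀, ∂₁ U z₀, ∂₂ U z₀, patchMeanCurvature c U z₀, ν]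
  refine ⟨Submodule.span ℝ (Set.range Y), ?_, fun l hl => hprop l z₀ ⟨hz₀, hzC⟩ fun i => ?_⟩
  · simpa [Set.finrank] using finrank_range_le_card (R := ℝ) Y
  · have hY : ∀ j, l (Y j) = 0 := fun j => hl _ (Submodule.subset_span ⟨j, rfl⟩)
    fin_cases i
    · exact hY 0
    · exact hY 1
    · exact hY 2
    · exact hY 3
    · change l (hopfRe c U z₀) = 0
      rw [ha, map_smul, show l ν = 0 from hY 4, smul_zero]
    · change l (hopfIm c U z₀) = 0
      rw [hb, map_smul, show l ν = 0 from hY 4, smul_zero]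

end IsParallelFlatPatch

end Quartic

/-! ### Totally geodesic space forms spanned by orthonormal tangent vectors -/

section TotallyGeodesic

variable {m n : ℕ} {c : ℝ}

/-- Cauchy-Schwarz and the two quadratic equations give `|c⟨x.2, y.2⟩| < |x.1 y.1|`, so the form has
the sign of `x.1 y.1`. It therefore detects the sheet of the hyperboloid, or the side of the
hyperplane pair if `c = 0`. -/
theorem fst_pos_iff_of_conormalForm {x y : FlatAmbient n} (hc : c ≤ 0) (hx : x ∈ spaceForm n c)
    (hy : conormalForm c y y = 1) : 0 < y.1 ↔ 0 < conormalForm c x y := by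
  have hx0 := hx.2 hc
  have hx1 := hx.1
  have hy1 : y.1 ^ 2 + c * ‖y.2‖ ^ 2 = 1 := by
    rw [← hy, conormalForm, real_inner_self_eq_norm_sq]; ring
  have hcs2 : (inner ℝ x.2 y.2) ^ 2 ≤ ‖x.2‖ ^ 2 * ‖y.2‖ ^ 2 := by
    rw [← mul_pow, ← sq_abs]
    exact pow_le_pow_left₀ (abs_nonneg _) (abs_real_inner_le_norm x.2 y.2) 2
  have hlt : (c * inner ℝ x.2 y.2) ^ 2 < (x.1 * y.1) ^ 2 := by
    have e1 : (c * inner ℝ x.2 y.2) ^ 2 ≤ (c * ‖x.2‖ ^ 2) * (c * ‖y.2‖ ^ 2) := by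
      have := mul_le_mul_of_nonneg_left hcs2 (sq_nonneg c)
      linarith
    have e2 : c * ‖x.2‖ ^ 2 = 1 - x.1 ^ 2 := by linarith
    have e3 : c * ‖y.2‖ ^ 2 = 1 - y.1 ^ 2 := by linarith
    have e4 : c * ‖x.2‖ ^ 2 ≤ 0 := mul_nonpos_of_nonpos_of_nonneg hc (by positivity)
    have e5 : c * ‖y.2‖ ^ 2 ≤ 0 := mul_nonpos_of_nonpos_of_nonneg hc (by positivity)
    rw [e2, e3] at e1
    nlinarith
  have habs := sq_lt_sq.1 hlt
  rw [conormalForm]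
  constructor
  · intro hy0
    rw [abs_of_pos (mul_pos hx0 hy0)] at habs
    linarith [neg_abs_le (c * inner ℝ x.2 y.2)]
  · intro hpos
    by_contra hy0
    push Not at hy0
    rw [abs_of_nonpos (mul_nonpos_of_nonneg_of_nonpos hx0.le hy0)] at habs
    linarith [le_abs_self (c * inner ℝ x.2 y.2)]

/-- The linear map `(t, y) ↦ t x + ∑ yᵢ bᵢ`. -/
noncomputable def frameMap (x : FlatAmbient n) (b : Fin m → FlatAmbient n) :
    FlatAmbient m →ₗ[ℝ] FlatAmbient n where
  toFun p := p.1 • x + ∑ i, p.2 i • b i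
  map_add' p q := by
    simp only [Prod.fst_add, Prod.snd_add, PiLp.add_apply, add_smul, Finset.sum_add_distrib]
    abel
  map_smul' r p := by
    simp only [Prod.smul_fst, Prod.smul_snd, PiLp.smul_apply, smul_eq_mul, mul_smul,
      RingHom.id_apply, smul_add, Finset.smul_sum]

theorem frameMap_apply (x : FlatAmbient n) (b : Fin m → FlatAmbient n) (p : FlatAmbient m) :
    frameMap x b p = p.1 • x + ∑ i, p.2 i • b i := rfl

theorem conormalForm_sum_right {ι : Type*} (s : Finset ι) (v : FlatAmbient n)
    (f : ι → FlatAmbient n) :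
    conormalForm c v (∑ i ∈ s, f i) = ∑ i ∈ s, conormalForm c v (f i) := by
  classical
  induction s using Finset.induction_on with
  | empty => simp [conormalForm]
  | insert a s ha ih => rw [Finset.sum_insert ha, Finset.sum_insert ha, conormalForm_add_right, ih]

theorem ambForm_sum_right {ι : Type*} (s : Finset ι) (v : FlatAmbient n)
    (f : ι → FlatAmbient n) : ambForm c v (∑ i ∈ s, f i) = ∑ i ∈ s, ambForm c v (f i) := by
  classical
  induction s using Finset.induction_on with
  | empty => simp [ambForm]
  | insert a s ha ih => rw [Finset.sum_insert ha, Finset.sum_insert ha, ambForm_add_right, ih]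

section Orthonormal

variable {x : FlatAmbient n} {b : Fin m → FlatAmbient n} (hx : x ∈ spaceForm n c)
  (hb : ∀ i, IsTangentAt c x (b i))
  (ho : ∀ i j, ambForm c (b i) (b j) = if i = j then 1 else 0)

include ho in
theorem ambForm_sum_frame (y y' : EuclideanSpace ℝ (Fin m)) :
    ambForm c (∑ i, y i • b i) (∑ i, y' i • b i) = inner ℝ y y' := by
  rw [ambForm_sum_right, PiLp.inner_apply]
  refine Finset.sum_congr rfl fun j _ => ?_
  rw [ambForm_comm, ambForm_sum_right, Finset.sum_eq_single j]
  · simp [ambForm_smul_left, ambForm_smul_right, ho, mul_comm]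
  · intro i _ hij
    rw [ambForm_smul_left, ambForm_smul_right, ho, if_neg (Ne.symm hij)]
    simp
  · simp

include hx hb

theorem conormalForm_point_frameMap (p : FlatAmbient m) :
    conormalForm c x (frameMap x b p) = p.1 := by
  rw [frameMap_apply, conormalForm_add_right, conormalForm_smul_right, conormalForm_self hx,
    conormalForm_sum_right, Finset.sum_eq_zero, mul_one, add_zero]
  intro i _
  rw [conormalForm_smul_right, show conormalForm c x (b i) = 0 from hb i, mul_zero]

include ho

/-- The conormal form is the invariant to follow: it defines the space form and the tangential
projection for every `c`, and determines the flat form when `c ≠ 0`. -/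
theorem conormalForm_frameMap (p q : FlatAmbient m) :
    conormalForm c (frameMap x b p) (frameMap x b q) = conormalForm c p q := by
  have ht : IsTangentAt c x (∑ i, p.2 i • b i) := by
    rw [IsTangentAt, conormalForm_sum_right]
    refine Finset.sum_eq_zero fun i _ => ?_
    rw [conormalForm_smul_right, show conormalForm c x (b i) = 0 from hb i, mul_zero]
  have e := conormalForm_point_frameMap hx hb q
  rw [conormalForm_comm, frameMap_apply x b p, conormalForm_add_right, conormalForm_smul_right,
    conormalForm_comm _ x, e, frameMap_apply, conormalForm_comm, conormalForm_add_right,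
    conormalForm_smul_right, conormalForm_comm _ x, show conormalForm c x _ = 0 from ht,
    conormalForm_of_tangent hx ht, ambForm_sum_frame ho, conormalForm]
  ring

theorem ambForm_frameMap {p v w : FlatAmbient m} (hp : p ∈ spaceForm m c)
    (hv : IsTangentAt c p v) (hw : IsTangentAt c p w) :
    ambForm c (frameMap x b v) (frameMap x b w) = ambForm c v w := by
  by_cases hc : c = 0
  · subst hc
    rw [frameMap_apply, frameMap_apply, hv.fst_eq_zero hp, hw.fst_eq_zero hp, zero_smul,
      zero_add, zero_add, ambForm_sum_frame ho]
    simp [ambForm]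
  · have e := conormalForm_frameMap hx hb ho v w
    rw [conormalForm_eq_mul_ambForm hc, conormalForm_eq_mul_ambForm hc] at e
    exact mul_left_cancel₀ hc e

theorem frameMap_injective : Function.Injective (frameMap x b) := by
  rw [← LinearMap.ker_eq_bot, LinearMap.ker_eq_bot']
  intro p hp
  have h1 : p.1 = 0 := by
    rw [← conormalForm_point_frameMap hx hb p, hp]
    simp [conormalForm]
  rw [frameMap_apply, h1, zero_smul, zero_add] at hp
  have h2 := ambForm_sum_frame ho p.2 p.2
  rw [hp] at h2
  have h3 : inner ℝ p.2 p.2 = (0 : ℝ) := by rw [← h2]; simp [ambForm]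
  exact Prod.ext h1 (inner_self_eq_zero.1 h3)

theorem frameMap_mem_iff (p : FlatAmbient m) :
    frameMap x b p ∈ spaceForm n c ↔ p ∈ spaceForm m c := by
  have e := conormalForm_frameMap hx hb ho p p
  have e1 : ∀ {k : ℕ} (q : FlatAmbient k), q.1 ^ 2 + c * ‖q.2‖ ^ 2 = conormalForm c q q := by
    intro k q
    rw [conormalForm, real_inner_self_eq_norm_sq]; ring
  simp only [spaceForm, Set.mem_ofPred_eq, e1, e]
  refine and_congr_right fun h1 => ?_
  refine forall_congr' fun hc => ?_
  rw [fst_pos_iff_of_conormalForm hc hx (e.trans h1), conormalForm_point_frameMap hx hb]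

/-- A linear map commutes with second derivatives, and one that preserves the conormal form also
intertwines the tangential projections; so it carries the geodesic equation over. -/
theorem isTotallyGeodesicSpaceForm_frameMap :
    IsTotallyGeodesicSpaceForm m n c (frameMap x b '' spaceForm m c) := by
  set L : FlatAmbient m →L[ℝ] FlatAmbient n := (frameMap x b).toContinuousLinearMap with hL
  have hLa : ∀ p, L p = frameMap x b p := fun p => rfl
  refine ⟨L, L.contDiff, ?_, ?_, ?_, ?_, rfl⟩
  · exact fun p hp => (frameMap_mem_iff hx hb ho p).2 hp
  · exact (LinearMap.isClosedEmbedding_of_injective (LinearMap.ker_eq_bot.2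
      (frameMap_injective hx hb ho))).isEmbedding.comp Topology.IsEmbedding.subtypeVal
  · intro p hp v w hv hw
    rw [L.fderiv]
    exact ambForm_frameMap hx hb ho hp hv hw
  · intro γ hγ
    have hd : ∀ t, HasDerivAt γ (deriv γ t) t := fun t =>
      (hγ.smooth.differentiable (by simp) t).hasDerivAt
    have hd2 : ∀ t, HasDerivAt (deriv γ) (deriv (deriv γ) t) t := fun t =>
      (((contDiff_infty_iff_deriv.1 hγ.smooth).2).differentiable (by simp) t).hasDerivAt
    have e1 : deriv (L ∘ γ) = fun t => L (deriv γ t) :=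
      funext fun t => (L.hasFDerivAt.comp_hasDerivAt t (hd t)).deriv
    have e2 : ∀ t, deriv (deriv (L ∘ γ)) t = L (deriv (deriv γ) t) := fun t => by
      rw [e1]; exact (L.hasFDerivAt.comp_hasDerivAt t (hd2 t)).deriv
    refine ⟨L.contDiff.comp hγ.smooth, fun t => (frameMap_mem_iff hx hb ho _).2 (hγ.mem t),
      fun t => ?_⟩
    have e3 := hγ.accel t
    rw [e2, tangentProj, Function.comp_apply, hLa, hLa, conormalForm_frameMap hx hb ho, ← map_smul,
      ← map_sub]
    rw [tangentProj] at e3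
    rw [e3, map_zero]

end Orthonormal

/-- The conormal form at `x` as a linear functional. -/
noncomputable def conormalFunctional (c : ℝ) (x : FlatAmbient n) : FlatAmbient n →ₗ[ℝ] ℝ where
  toFun := conormalForm c x
  map_add' := conormalForm_add_right x
  map_smul' r v := conormalForm_smul_right r x v

/-- The tangent space of the space form at `x`. -/
noncomputable def tangentSubmodule (c : ℝ) (x : FlatAmbient n) : Submodule ℝ (FlatAmbient n) :=
  LinearMap.ker (conormalFunctional c x)

theorem le_finrank_tangentSubmodule (x : FlatAmbient n) :
    n ≤ Module.finrank ℝ (tangentSubmodule c x) := by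
  have h := LinearMap.finrank_range_add_finrank_ker (conormalFunctional c x)
  have h1 : Module.finrank ℝ (FlatAmbient n) = n + 1 := by
    simp [FlatAmbient, add_comm]
  have h2 := Submodule.finrank_le (LinearMap.range (conormalFunctional c x))
  rw [Module.finrank_self] at h2
  rw [tangentSubmodule]
  omega

theorem Submodule.exists_le_le_finrank_eq {K V : Type*} [Field K] [AddCommGroup V] [Module K V]
    [FiniteDimensional K V] {S T : Submodule K V} (hST : S ≤ T) {k : ℕ}
    (h1 : Module.finrank K S ≤ k) (h2 : k ≤ Module.finrank K T) :
    ∃ R : Submodule K V, S ≤ R ∧ R ≤ T ∧ Module.finrank K R = k := by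
  induction k, h1 using Nat.le_induction with
  | base => exact ⟨S, le_rfl, hST, rfl⟩
  | succ k hk ih =>
    obtain ⟨R, hSR, hRT, hR⟩ := ih (by omega)
    have hlt : R < T := lt_of_le_of_ne hRT fun h => by subst h; omega
    obtain ⟨v, hvT, hvR⟩ := SetLike.exists_of_lt hlt
    have hv0 : v ≠ 0 := fun h => hvR (h ▸ R.zero_mem)
    refine ⟨R ⊔ K ∙ v, hSR.trans le_sup_left,
      sup_le hRT ((Submodule.span_singleton_le_iff_mem v T).2 hvT), ?_⟩
    have e := Submodule.finrank_sup_add_finrank_inf_eq R (K ∙ v)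
    rw [(Submodule.disjoint_span_singleton' hv0).2 hvR |>.eq_bot, finrank_bot,
      finrank_span_singleton hv0, hR] at e
    omega

/-- The flat form as a bilinear form. -/
noncomputable def ambBilin (c : ℝ) : LinearMap.BilinForm ℝ (FlatAmbient n) :=
  LinearMap.mk₂ ℝ (ambForm c) ambForm_add_left ambForm_smul_left ambForm_add_right
    ambForm_smul_right

/-- The ambient form may be indefinite or degenerate. Its restriction to `T` has an orthogonal basis
as a symmetric form, and positivity on tangent vectors allows normalisation. -/
theorem exists_orthonormal_span {x : FlatAmbient n} (hx : x ∈ spaceForm n c)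
    (T : Submodule ℝ (FlatAmbient n)) (hT : T ≤ tangentSubmodule c x)
    (hm : Module.finrank ℝ T = m) : ∃ b : Fin m → FlatAmbient n, (∀ i, IsTangentAt c x (b i)) ∧
      (∀ i j, ambForm c (b i) (b j) = if i = j then 1 else 0) ∧
      Submodule.span ℝ (Set.range b) = T := by
  subst hm
  obtain ⟨v, hv⟩ := LinearMap.BilinForm.exists_orthogonal_basis
    (B := ((ambBilin c).compl₁₂ T.subtype T.subtype : LinearMap.BilinForm ℝ T))
    ⟨fun v w => ambForm_comm (v : FlatAmbient n) w⟩
  have hpos : ∀ i, 0 < ambForm c (v i : FlatAmbient n) (v i) := fun i =>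
    ambForm_self_pos_of_tangent hx (hT (v i).2) fun h0 => v.ne_zero i (Subtype.ext h0)
  refine ⟨fun i => (√(ambForm c (v i : FlatAmbient n) (v i)))⁻¹ • (v i : FlatAmbient n),
    fun i => ?_, fun i j => ?_, ?_⟩
  · exact (tangentSubmodule c x).smul_mem _ (hT (v i).2)
  · rw [ambForm_smul_left, ambForm_smul_right]
    split_ifs with hij
    · subst hij
      rw [← mul_assoc, ← mul_inv, Real.mul_self_sqrt (hpos i).le, inv_mul_cancel₀ (hpos i).ne']
    · have h0 : ambForm c (v i : FlatAmbient n) (v j) = 0 := hv hij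
      rw [h0, mul_zero, mul_zero]
  · apply le_antisymm
    · rw [Submodule.span_le]
      rintro _ ⟨i, rfl⟩
      exact T.smul_mem _ (v i).2
    · intro w hw
      have hrep := v.sum_repr ⟨w, hw⟩
      have hrep' : w = ∑ i, v.repr ⟨w, hw⟩ i • (v i : FlatAmbient n) := by
        have h1 := congrArg T.subtype hrep
        rw [map_sum] at h1
        simpa only [map_smul, Submodule.subtype_apply] using h1.symm
      rw [hrep']
      refine Submodule.sum_mem _ fun i _ => Submodule.smul_mem _ _ ?_
      have := Submodule.subset_span (R := ℝ) (Set.mem_range_self (f := fun i =>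
        (√(ambForm c (v i : FlatAmbient n) (v i)))⁻¹ • (v i : FlatAmbient n)) i)
      have h2 := Submodule.smul_mem _ (√(ambForm c (v i : FlatAmbient n) (v i))) this
      rwa [smul_smul, mul_inv_cancel₀ (Real.sqrt_ne_zero'.2 (hpos i)), one_smul] at h2

/-- Since `x ∈ W`, the space `W` is the sum of `ℝ x` and its tangent part at `x`. That part has
dimension at most `m`; it is enlarged to dimension exactly `m` inside the tangent space and framed
orthonormally. -/
theorem exists_isTotallyGeodesicSpaceForm {x : FlatAmbient n} (hx : x ∈ spaceForm n c)
    (W : Submodule ℝ (FlatAmbient n)) (hxW : x ∈ W) (hm : m ≤ n)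
    (hW : Module.finrank ℝ W ≤ m + 1) :
    ∃ P : Set (FlatAmbient n), IsTotallyGeodesicSpaceForm m n c P ∧
      ∀ y ∈ spaceForm n c, y ∈ W → y ∈ P := by
  have hxT : x ∉ tangentSubmodule c x := fun h => by
    have h0 : conormalForm c x x = 0 := h
    rw [conormalForm_self hx] at h0
    exact one_ne_zero h0
  have hlt : W ⊓ tangentSubmodule c x < W :=
    lt_of_le_of_ne inf_le_left fun h => by
      rw [← h] at hxW
      exact hxT hxW.2
  have hfin : Module.finrank ℝ (W ⊓ tangentSubmodule c x : Submodule ℝ (FlatAmbient n)) ≤ m := by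
    have := Submodule.finrank_lt_finrank_of_lt hlt
    omega
  obtain ⟨R, hSR, hRT, hR⟩ := Submodule.exists_le_le_finrank_eq inf_le_right hfin
    (hm.trans (le_finrank_tangentSubmodule x))
  obtain ⟨b, hb, ho, hspan⟩ := exists_orthonormal_span hx R hRT hR
  refine ⟨_, isTotallyGeodesicSpaceForm_frameMap hx hb ho, fun y hy hyW => ?_⟩
  have hmem : y - conormalForm c x y • x ∈ R := by
    refine hSR ⟨W.sub_mem hyW (W.smul_mem _ hxW), ?_⟩
    change conormalForm c x _ = 0
    rw [conormalForm_sub_right, conormalForm_smul_right, conormalForm_self hx]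
    ring
  rw [← hspan, Submodule.mem_span_range_iff_exists_fun] at hmem
  obtain ⟨a, ha⟩ := hmem
  have hya : frameMap x b (conormalForm c x y, WithLp.toLp 2 a) = y := by
    rw [frameMap_apply]
    simp only
    rw [ha]
    abel
  exact ⟨_, (frameMap_mem_iff hx hb ho _).1 (by rw [hya]; exact hy), hya⟩

end TotallyGeodesic

/-! ### Coordinate patches of a bordered Riemann surface -/

section Charts

theorem range_halfPlaneModel : Set.range halfPlaneModel = {z : ℂ | 0 ≤ z.im} :=
  range_closedHalfPlane_val

theorem uniqueDiffOn_closedHalfPlane : UniqueDiffOn ℝ {z : ℂ | 0 ≤ z.im} := by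
  refine uniqueDiffOn_convex (convex_halfSpace_im_ge 0) ⟨Complex.I, ?_⟩
  rw [Complex.interior_setOfPred_le_im]
  simp

theorem setOf_im_nonneg_mem_nhds {z : ℂ} (hz : 0 < z.im) : {w : ℂ | 0 ≤ w.im} ∈ 𝓝 z :=
  Filter.mem_of_superset ((isOpen_lt continuous_const Complex.continuous_im).mem_nhds hz)
    fun w (hw : 0 < w.im) => (hw.le : 0 ≤ w.im)

variable {S : Type*} [TopologicalSpace S] {n : ℕ} {c : ℝ} {u : S → FlatAmbient n}
  {e e' : OpenPartialHomeomorph S ClosedHalfPlane} {Ω : Set ℂ} {z : ℂ}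
  {F : Type*} [NormedAddCommGroup F] [NormedSpace ℝ F]

theorem coordDeriv_extend_symm (g : S → F) (v : ℂ)
    (hz : z ∈ (e.extend halfPlaneModel).target) (him : 0 < z.im) :
    coordDeriv e g v ((e.extend halfPlaneModel).symm z) =
      planeDeriv v (g ∘ (e.extend halfPlaneModel).symm) z := by
  rw [coordDeriv, (e.extend halfPlaneModel).right_inv hz,
    fderivWithin_of_mem_nhds (setOf_im_nonneg_mem_nhds him), planeDeriv]

theorem coordDeriv_of_eqOn {g : S → F} {G : ℂ → F} (hop : IsOpen Ω)
    (ht : Ω ⊆ (e.extend halfPlaneModel).target) (him : ∀ z ∈ Ω, 0 < z.im)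
    (hg : ∀ w ∈ Ω, g ((e.extend halfPlaneModel).symm w) = G w) (hz : z ∈ Ω) (v : ℂ) :
    coordDeriv e g v ((e.extend halfPlaneModel).symm z) = planeDeriv v G z := by
  rw [coordDeriv_extend_symm g v (ht hz) (him z hz)]
  exact planeDeriv_congr hop hg hz

theorem normalPart_tangentProj_eq (hz : z ∈ (e.extend halfPlaneModel).target) (him : 0 < z.im)
    (X : FlatAmbient n) :
    normalPart c u e ((e.extend halfPlaneModel).symm z)
      (tangentProj c (u ((e.extend halfPlaneModel).symm z)) X) =
      patchNormal c (u ∘ (e.extend halfPlaneModel).symm) z X := by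
  rw [normalPart, coordDeriv_extend_symm u _ hz him, coordDeriv_extend_symm u _ hz him,
    patchNormal, normalProj_apply]
  rfl

variable [ChartedSpace ClosedHalfPlane S]

theorem SmoothOnSurface.contDiffOn (hu : SmoothOnSurface u Set.univ)
    (he : e ∈ atlas ClosedHalfPlane S) : ContDiffOn ℝ ∞ (u ∘ (e.extend halfPlaneModel).symm)
      (e.extend halfPlaneModel).target := by
  simpa using hu e he

theorem SmoothOnSurface.continuous (hu : SmoothOnSurface u Set.univ) : Continuous u := by
  rw [continuous_iff_continuousAt]
  intro p
  set e := chartAt ClosedHalfPlane p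
  have h1 := (hu.contDiffOn (chart_mem_atlas ClosedHalfPlane p)).continuousOn
  have h2 : ContinuousOn ((u ∘ (e.extend halfPlaneModel).symm) ∘ e.extend halfPlaneModel)
      (e.extend halfPlaneModel).source :=
    h1.comp (e.continuousOn_extend) (e.extend halfPlaneModel).mapsTo
  have h3 : ContinuousOn u (e.extend halfPlaneModel).source :=
    h2.congr fun q hq => by
      simp only [Function.comp_apply, (e.extend halfPlaneModel).left_inv hq]
  exact h3.continuousAt (e.extend_source_mem_nhds (mem_chart_source _ p))

variable [IsManifold halfPlaneModel ∞ S]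

/-- Chain rule within the closed half plane, valid at boundary points too. It frees `branchSet` from
the preferred chart in its definition. -/
theorem coordDeriv_eq_zero_of_coordDeriv_eq_zero (hu : SmoothOnSurface u Set.univ)
    (he : e ∈ atlas ClosedHalfPlane S) (he' : e' ∈ atlas ClosedHalfPlane S) {p : S}
    (hp : p ∈ e.source) (hp' : p ∈ e'.source) (h0 : ∀ v, coordDeriv e u v p = 0) (v : ℂ) :
    coordDeriv e' u v p = 0 := by
  set φ := e.extend halfPlaneModel with hφ
  set φ' := e'.extend halfPlaneModel with hφ'
  have hd : HasFDerivWithinAt (u ∘ φ.symm) (0 : ℂ →L[ℝ] FlatAmbient n) {z : ℂ | 0 ≤ z.im}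
      (φ p) := by
    have h1 : DifferentiableWithinAt ℝ (u ∘ φ.symm) {z : ℂ | 0 ≤ z.im} (φ p) := by
      refine (((hu.contDiffOn he).differentiableOn (by simp)) (φ p)
        (φ.map_source (by rwa [hφ, e.extend_source]))).mono_of_mem_nhdsWithin ?_
      rw [← range_halfPlaneModel]
      exact e.extend_target_mem_nhdsWithin hp
    have h2 := h1.hasFDerivWithinAt
    rwa [show fderivWithin ℝ (u ∘ φ.symm) {z : ℂ | 0 ≤ z.im} (φ p) = 0 from
      ContinuousLinearMap.ext h0] at h2
  have hτ : DifferentiableWithinAt ℝ (φ ∘ φ'.symm) {z : ℂ | 0 ≤ z.im} (φ' p) := by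
    have h1 := halfPlaneModel.contDiffWithinAt_extendCoordChange' (n := ∞)
      (IsManifold.subset_maximalAtlas he') (IsManifold.subset_maximalAtlas he) hp' hp
    rw [range_halfPlaneModel] at h1
    exact (h1.restrict_scalars ℝ).differentiableWithinAt (by simp)
  have hleft : φ'.symm (φ' p) = p := e'.extend_left_inv hp'
  have hcomp := HasFDerivWithinAt.comp (φ' p) (g := u ∘ φ.symm) (f := φ ∘ φ'.symm)
    (t := {z : ℂ | 0 ≤ z.im}) (by rw [Function.comp_apply, hleft]; exact hd)
    hτ.hasFDerivWithinAt (fun w _ => by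
      rw [← range_halfPlaneModel]
      exact Set.mem_range_self _)
  rw [ContinuousLinearMap.zero_comp] at hcomp
  have hev : u ∘ φ'.symm =ᶠ[𝓝[{z : ℂ | 0 ≤ z.im}] (φ' p)] (u ∘ φ.symm) ∘ (φ ∘ φ'.symm) := by
    have hsrc := halfPlaneModel.extendCoordChange_source_mem_nhdsWithin' hp' hp
    rw [range_halfPlaneModel] at hsrc
    filter_upwards [hsrc] with w hw
    have hw2 : φ'.symm w ∈ φ.source := hw.2
    simp only [Function.comp_apply, φ.left_inv hw2]
  have hmem : φ' p ∈ {z : ℂ | 0 ≤ z.im} := by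
    rw [← range_halfPlaneModel]; exact Set.mem_range_self _
  have hfin := (hcomp.congr_of_eventuallyEq hev (hev.self_of_nhdsWithin hmem)).fderivWithin
    (uniqueDiffOn_closedHalfPlane _ hmem)
  rw [coordDeriv]
  change fderivWithin ℝ (u ∘ φ'.symm) {z : ℂ | 0 ≤ z.im} (φ' p) v = 0
  rw [hfin]
  rfl

theorem mem_branchSet_iff_coordDeriv (hu : SmoothOnSurface u Set.univ)
    (he : e ∈ atlas ClosedHalfPlane S) {p : S} (hp : p ∈ e.source) :
    p ∈ branchSet u ↔ ∀ v, coordDeriv e u v p = 0 :=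
  ⟨fun h => coordDeriv_eq_zero_of_coordDeriv_eq_zero hu (chart_mem_atlas _ p) he
    (mem_chart_source _ p) hp h,
  fun h => coordDeriv_eq_zero_of_coordDeriv_eq_zero hu he (chart_mem_atlas _ p) hp
    (mem_chart_source _ p) h⟩

/-- Turns fields on a plane domain into smooth fields on the surface, as needed to apply the
flatness hypothesis to normal fields of a patch. -/
theorem smoothOnSurface_comp_extend (he : e ∈ atlas ClosedHalfPlane S) {ξ : ℂ → F}
    (hξ : ContDiffOn ℝ ∞ ξ Ω) :
    SmoothOnSurface (ξ ∘ e.extend halfPlaneModel)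
      (e.source ∩ e.extend halfPlaneModel ⁻¹' Ω) := by
  intro e' he'
  have hτ := (halfPlaneModel.contDiffOn_extendCoordChange (n := ∞)
    (IsManifold.subset_maximalAtlas he') (IsManifold.subset_maximalAtlas he)).restrict_scalars ℝ
  refine hξ.comp (hτ.mono ?_) ?_
  · rintro w ⟨hw, hw2⟩
    exact ⟨hw, by rw [Set.mem_preimage, e.extend_source]; exact hw2.1⟩
  · rintro w ⟨-, hw2⟩
    exact hw2.2

/-- Off the branch points the interior of a coordinate chart is a patch. -/
theorem isParallelFlatPatch_of_chart (hu : IsBranchedImmersion c u)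
    (hparallel : HasParallelMeanCurvature c u) (hflat : HasFlatNormalBundle c u)
    (he : e ∈ atlas ClosedHalfPlane S) (hop : IsOpen Ω)
    (ht : Ω ⊆ (e.extend halfPlaneModel).target) (him : ∀ z ∈ Ω, 0 < z.im)
    (hne : ∀ z ∈ Ω, ambForm c (∂₁ (u ∘ (e.extend halfPlaneModel).symm) z)
      (∂₁ (u ∘ (e.extend halfPlaneModel).symm) z) ≠ 0) :
    IsParallelFlatPatch c (u ∘ (e.extend halfPlaneModel).symm) Ω := by
  set φ := e.extend halfPlaneModel with hφ
  have hsrc : ∀ z ∈ Ω, φ.symm z ∈ e.source := fun z hz => by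
    rw [← e.extend_source (I := halfPlaneModel)]; exact φ.map_target (ht hz)
  have hcd : ∀ z ∈ Ω, ∀ v, coordDeriv e u v (φ.symm z) = planeDeriv v (u ∘ φ.symm) z :=
    fun z hz v => coordDeriv_extend_symm u v (ht hz) (him z hz)
  have hnb : ∀ z ∈ Ω, φ.symm z ∉ branchSet u := fun z hz hb => by
    have h0 := (mem_branchSet_iff_coordDeriv hu.smooth he (hsrc z hz)).1 hb 1
    rw [hcd z hz] at h0
    exact hne z hz (by rw [h0, ambForm_zero_right])
  have hN : ∀ z ∈ Ω, ∀ X, normalPart c u e (φ.symm z) (tangentProj c (u (φ.symm z)) X) =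
      patchNormal c (u ∘ φ.symm) z X := fun z hz X =>
    normalPart_tangentProj_eq (ht hz) (him z hz) X
  have hA : ∀ z ∈ Ω, ∀ v w, secondFundForm c u e v w (φ.symm z) =
      patchNormal c (u ∘ φ.symm) z (planeDeriv v (planeDeriv w (u ∘ φ.symm)) z) :=
    fun z hz v w => by
      rw [secondFundForm, ambientCovDeriv, hN z hz,
        coordDeriv_of_eqOn hop ht him (fun x hx => hcd x hx w) hz]
  have hcov : ∀ z ∈ Ω, ∀ (v : ℂ) (ξ : S → FlatAmbient n) (X : ℂ → FlatAmbient n),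
      (∀ w ∈ Ω, ξ (φ.symm w) = X w) → normalCovDeriv c u e v ξ (φ.symm z) =
        patchNormal c (u ∘ φ.symm) z (planeDeriv v X z) := fun z hz v ξ X hX => by
    rw [normalCovDeriv, ambientCovDeriv, hN z hz, coordDeriv_of_eqOn hop ht him hX hz]
  have hH : ∀ z ∈ Ω, meanCurvature c u e (φ.symm z) = patchMeanCurvature c (u ∘ φ.symm) z :=
    fun z hz => by
      rw [meanCurvature, hA z hz, hA z hz, hcd z hz, hcd z hz, patchMeanCurvature]
  refine ⟨⟨hop, (hu.smooth.contDiffOn he).mono ht, fun z _ => hu.mem _, fun z hz => ?_,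
    fun z hz => ?_, hne⟩, fun z hz v => ?_, fun ξ hξ z hz => ?_⟩
  · simpa only [hcd z hz] using hu.conformal_norm e he _ (hsrc z hz)
  · simpa only [hcd z hz] using hu.conformal_orthogonal e he _ (hsrc z hz)
  · rw [← hcov z hz v _ _ hH]
    exact hparallel e he _ (hsrc z hz) (hnb z hz) v
  · have hinv : ∀ q ∈ e.source, φ.symm (φ q) = q := fun q hq => e.extend_left_inv hq
    have hξ' : ∀ w ∈ Ω, (ξ ∘ φ) (φ.symm w) = ξ w := fun w hw => by
      rw [Function.comp_apply, φ.right_inv (ht hw)]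
    have hsec : IsNormalSection c u e (e.source ∩ φ ⁻¹' Ω) (ξ ∘ φ) := by
      refine ⟨smoothOnSurface_comp_extend he hξ.smooth, ?_, ?_⟩
      · rintro q ⟨hq, hqΩ⟩
        have := (hξ.normal _ hqΩ).tangent
        rwa [Function.comp_apply, hinv q hq] at this
      · rintro q ⟨hq, hqΩ⟩ v
        have h1 := hξ.normal _ hqΩ
        have h2 := hcd _ hqΩ v
        rw [hinv q hq] at h2
        rw [h2, planeDeriv_eq_re_im, ambForm_add_right, ambForm_smul_right, ambForm_smul_right,
          Function.comp_apply, h1.orth_fst, h1.orth_snd]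
        ring
    have hcurv := hflat e he _ (e.isOpen_extend_preimage (I := halfPlaneModel) hop)
      (by
        rintro q ⟨hq, hqΩ⟩
        refine ⟨hq, ?_⟩
        have := hnb _ hqΩ
        rwa [hinv q hq] at this) _ hsec (φ.symm z)
      ⟨hsrc z hz, by rw [Set.mem_preimage, ← hφ, φ.right_inv (ht hz)]; exact hz⟩ 1 Complex.I
    rw [normalCurvature, hcov z hz 1 _ _ (fun w hw => hcov w hw Complex.I _ _ hξ'),
      hcov z hz Complex.I _ _ (fun w hw => hcov w hw 1 _ _ hξ')] at hcurv
    exact sub_eq_zero.1 hcurv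

/-- Every point has a neighbourhood in the closure of a connected patch. -/
theorem exists_patch_neighbourhood (hu : IsBranchedImmersion c u)
    (hparallel : HasParallelMeanCurvature c u) (hflat : HasFlatNormalBundle c u) (p : S) :
    ∃ (Ω : Set ℂ) (N : Set S) (ψ : ℂ → S), IsPreconnected Ω ∧ IsParallelFlatPatch c (u ∘ ψ) Ω ∧
      ContinuousOn ψ Ω ∧ IsOpen (ψ '' Ω) ∧ IsOpen N ∧ p ∈ N ∧ N ⊆ closure (ψ '' Ω) := by
  set e := chartAt ClosedHalfPlane p with he_def
  have he : e ∈ atlas ClosedHalfPlane S := chart_mem_atlas _ p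
  have hp : p ∈ e.source := mem_chart_source _ p
  set φ := e.extend halfPlaneModel with hφ
  set U := u ∘ φ.symm with hU
  have hnhds := e.extend_target_mem_nhdsWithin (I := halfPlaneModel) hp
  rw [range_halfPlaneModel, Metric.mem_nhdsWithin_iff] at hnhds
  obtain ⟨r, hr, hball⟩ := hnhds
  -- The centre may be a boundary point or a branch point, so only the closure of the final patch is
  -- sure to contain `p`.
  set Ω₀ : Set ℂ := Metric.ball (φ p) r ∩ {z : ℂ | 0 < z.im} with hΩ₀
  have hop₀ : IsOpen Ω₀ :=
    Metric.isOpen_ball.inter (isOpen_lt continuous_const Complex.continuous_im)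
  have ht₀ : Ω₀ ⊆ φ.target := fun z hz => hball ⟨hz.1, (show 0 < z.im from hz.2).le⟩
  have hsm₀ : ContDiffOn ℝ ∞ U Ω₀ := (hu.smooth.contDiffOn he).mono ht₀
  have hsrc : ∀ z ∈ Ω₀, φ.symm z ∈ e.source := fun z hz => by
    rw [← e.extend_source (I := halfPlaneModel)]; exact φ.map_target (ht₀ hz)
  have hcd : ∀ z ∈ Ω₀, ∀ v, coordDeriv e u v (φ.symm z) = planeDeriv v U z :=
    fun z hz v => coordDeriv_extend_symm u v (ht₀ hz) hz.2
  set C : Set ℂ := Ω₀ ∩ {z | ambForm c (∂₁ U z) (∂₁ U z) = 0} with hC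
  have hbranch : ∀ z ∈ C, φ.symm z ∈ branchSet u := by
    rintro z ⟨hz, hz0⟩
    have hzero : ∀ v, ambForm c (planeDeriv v U z) (planeDeriv v U z) = 0 →
        planeDeriv v U z = 0 := fun v hv => by
      by_contra hne
      exact (ambForm_self_pos_of_tangent (hu.mem _)
        (conormalForm_planeDeriv_eq_zero hop₀ hsm₀ (fun z _ => hu.mem _) hz v) hne).ne' hv
    have hconf := hu.conformal_norm e he _ (hsrc z hz)
    rw [hcd z hz, hcd z hz] at hconf
    rw [mem_branchSet_iff_coordDeriv hu.smooth he (hsrc z hz)]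
    intro v
    rw [hcd z hz, planeDeriv_eq_re_im, hzero 1 hz0, hzero Complex.I (hconf ▸ hz0), smul_zero,
      smul_zero, add_zero]
  -- The coordinate injects `C` continuously into the discrete branch set, so `C` is itself
  -- discrete, and a discrete subset of `ℂ` is countable.
  have hCc : C.Countable := by
    apply IsDiscrete.countable_of_secondCountable
    have := hu.discrete_branchSet.to_subtype
    refine ⟨DiscreteTopology.of_continuous_injective
      (f := fun z : C => (⟨φ.symm z, hbranch z z.2⟩ : branchSet u)) ?_ ?_⟩
    · refine Continuous.subtype_mk ?_ _
      exact continuousOn_iff_continuous_domRestrict.1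
        (e.continuousOn_extend_symm.mono fun z hz => ht₀ hz.1)
    · intro z w hzw
      exact Subtype.ext (φ.symm.injOn (ht₀ z.2.1) (ht₀ w.2.1) (congrArg Subtype.val hzw))
  have hopΩ : IsOpen (Ω₀ \ C) := by
    have : Ω₀ \ C = Ω₀ ∩ (fun z => ambForm c (∂₁ U z) (∂₁ U z)) ⁻¹' {0}ᶜ := by
      ext z; simp [hC]
    rw [this]
    exact (ContDiffOn.ambForm (hsm₀.planeDeriv hop₀ 1)
      (hsm₀.planeDeriv hop₀ 1)).continuousOn.isOpen_inter_preimage hop₀ isOpen_compl_singleton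
  have htΩ : Ω₀ \ C ⊆ φ.target := fun z hz => ht₀ hz.1
  have hconv : IsPreconnected Ω₀ :=
    ((convex_ball _ _).inter (convex_halfSpace_im_gt 0)).isPreconnected
  refine ⟨Ω₀ \ C, e.source ∩ φ ⁻¹' Metric.ball (φ p) r, φ.symm,
    hconv.diff_countable hop₀ hCc,
    isParallelFlatPatch_of_chart hu hparallel hflat he hopΩ htΩ (fun z hz => hz.1.2)
      fun z hz h0 => hz.2 ⟨hz.1, h0⟩,
    e.continuousOn_extend_symm.mono htΩ, ?_, e.isOpen_extend_preimage Metric.isOpen_ball,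
    ⟨hp, Metric.mem_ball_self hr⟩, ?_⟩
  · have himg : φ.symm '' (Ω₀ \ C) = e.source ∩ φ ⁻¹' (Ω₀ \ C) := by
      rw [← e.extend_source (I := halfPlaneModel)]
      exact φ.symm.image_eq_target_inter_inv_preimage htΩ
    rw [himg]
    exact e.isOpen_extend_preimage hopΩ
  · rintro q ⟨hq, hqb⟩
    have him : φ q ∈ closure {z : ℂ | 0 < z.im} := by
      rw [Complex.closure_setOfPred_lt_im, ← range_halfPlaneModel]
      exact Set.mem_range_self _
    have h1 : φ q ∈ closure Ω₀ := Metric.isOpen_ball.inter_closure ⟨hqb, him⟩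
    have h2 : φ q ∈ closure (Ω₀ \ C) :=
      closure_minimal ((hCc.dense_compl ℝ).open_subset_closure_inter hop₀) isClosed_closure h1
    have h3 := (e.continuousAt_extend_symm (I := halfPlaneModel)
      hq).continuousWithinAt.mem_closure_image h2
    rwa [e.extend_left_inv hq] at h3

end Charts

/-! ### Globalisation over the connected surface -/

theorem mainTheorem4 {S : Type*} [TopologicalSpace S] [T2Space S] [ConnectedSpace S]
    [ChartedSpace ClosedHalfPlane S] [IsManifold halfPlaneModel ∞ S]
    (n : ℕ) (hn : 4 ≤ n) (c : ℝ) (u : S → FlatAmbient n)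
    (hu : IsBranchedImmersion c u)
    (hparallel : HasParallelMeanCurvature c u)
    (hnonzero : ¬ MeanCurvatureVanishes c u)
    (hflat : HasFlatNormalBundle c u) :
    ∃ P : Set (FlatAmbient n), IsTotallyGeodesicSpaceForm 4 n c P ∧ Set.range u ⊆ P := by
  obtain ⟨p₀⟩ : Nonempty S := inferInstance
  have hcont : Continuous u := hu.smooth.continuous
  obtain ⟨Ω, N, ψ, hΩ, hpatch, -, hopen, -, hpN, hN⟩ :=
    exists_patch_neighbourhood hu hparallel hflat p₀
  have hne : (ψ '' Ω).Nonempty := closure_nonempty_iff.1 ⟨p₀, hN hpN⟩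
  obtain ⟨W, hW, hWl⟩ := hpatch.exists_submodule hΩ (Set.image_nonempty.1 hne)
  have hmem : ∀ q, u q ∈ W := by
    by_contra! hcon
    obtain ⟨q₀, hq₀⟩ := hcon
    -- A functional vanishing on `W` but not at `u q₀` is refuted by showing that it vanishes along
    -- all of `u`.
    obtain ⟨f, hf, hWf⟩ := Submodule.exists_le_ker_of_notMem hq₀
    set l : FlatAmbient n →L[ℝ] ℝ := f.toContinuousLinearMap with hl
    have hlW : ∀ w ∈ W, l w = 0 := fun w hw => hWf hw
    set T : Set S := {q | ∀ᶠ q' in 𝓝 q, l (u q') = 0} with hT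
    have hTopen : IsOpen T := isOpen_setOfPred_eventually_nhds
    have hTzero : ∀ q ∈ T, l (u q) = 0 := fun q hq =>
      Filter.Eventually.self_of_nhds (p := fun q' => l (u q') = 0) hq
    have hTclosed : IsClosed T := by
      refine isClosed_of_closure_subset fun q hq => ?_
      obtain ⟨Ω', N', ψ', hΩ', hpatch', hψ', hopen', hN'o, hqN', hN'⟩ :=
        exists_patch_neighbourhood hu hparallel hflat q
      obtain ⟨a, haN, haT⟩ := mem_closure_iff.1 hq N' hN'o hqN'
      -- The patch at a limit point of `T` meets the open set `T`. Unique continuation then gives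
      -- vanishing on the whole patch, hence on its closure, which contains a neighbourhood of the
      -- limit point.
      obtain ⟨b, ⟨-, hbT⟩, ⟨z, hz, rfl⟩⟩ := mem_closure_iff.1 (hN' haN) (N' ∩ T)
        (hN'o.inter hTopen) ⟨haN, haT⟩
      have hzero := hpatch'.unique_continuation hΩ'
        (hψ'.isOpen_inter_preimage hpatch'.isOpen hTopen) ⟨z, hz, hbT⟩ Set.inter_subset_left l
        fun w hw => hTzero (ψ' w) hw.2
      have hclosed : IsClosed {q | l (u q) = 0} :=
        isClosed_eq (l.continuous.comp hcont) continuous_const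
      have hsub : closure (ψ' '' Ω') ⊆ {q | l (u q) = 0} := by
        refine closure_minimal ?_ hclosed
        rintro _ ⟨w, hw, rfl⟩
        exact hzero w hw
      exact Filter.eventually_of_mem (hN'o.mem_nhds hqN') fun q' hq' => hsub (hN' hq')
    have hTne : T.Nonempty := by
      obtain ⟨q, hq⟩ := hne
      refine ⟨q, Filter.eventually_of_mem (hopen.mem_nhds hq) ?_⟩
      rintro _ ⟨w, hw, rfl⟩
      exact hWl l hlW w hw
    have huniv : T = Set.univ := IsClopen.eq_univ ⟨hTclosed, hTopen⟩ hTne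
    exact hf (hTzero q₀ (huniv ▸ Set.mem_univ q₀))
  obtain ⟨P, hP, hPW⟩ := exists_isTotallyGeodesicSpaceForm (hu.mem p₀) W (hmem p₀) hn hW
  refine ⟨P, hP, ?_⟩
  rintro _ ⟨q, rfl⟩
  exact hPW _ (hu.mem q) (hmem q)
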